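/- Let $\alpha\in(0,1)$ and $\tau(w)=w^\alpha$ for $w\ge0$. Then $\tau:[0,\infty)\to[0,\infty)$ is nondecreasing, concave and continuous with $\tau(0)=0$. Extend $\tau$ by $-\infty$ to $(-\infty,0)$, and let $[-\tau(-\cdot)]^*(t)=\sup_{w\ge0}\,(\tau(w)-tw)$ be the Legendre--Fenchel conjugate of $x\mapsto-\tau(-x)$. It satisfies $$[-\tau(-\cdot)]^*(t)=(1-\alpha)\Big(\frac t\alpha\Big)^{\frac\alpha{\alpha-1}}\quad(t>0),\qquad [-\tau(-\cdot)]^*(0)=\infty.$$ Let $r(s)=\frac{2\sqrt2}{3\sqrt{-s}}$ for $s<0$ and $r(s)=0$ for $s\ge0$, let $\beta=\frac12+\frac\alpha{1-\alpha}$, and let $$K=\frac{1-\alpha}\alpha\,\alpha^{\frac1{1-\alpha}}\,\frac{2\beta-1}{2\sqrt{2\pi}}\,\frac{3\Gamma(\beta)}{2\Gamma(\beta+\frac12)}.$$ Then $K=\alpha^{\frac1{1-\alpha}}\frac1{\sqrt{2\pi}}\frac{3\Gamma(\frac12+\frac\alpha{1-\alpha})}{2\Gamma(1+\frac\alpha{1-\alpha})}>0$,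 and the function $g:[0,\infty)\to[0,\infty]$, $g(s)=Ks^{-\beta}$ (with $g(0)=\infty$), solves the deconvolution problem $$[-\tau(-\cdot)]^*(t)=[g*r](t)=\int_t^\infty g(s)\,r(t-s)\,ds\qquad\text{for all }t\ge0,$$ as an identity in $[0,\infty]$. For $f:[0,\infty)\to[0,\infty]$ let $f^{-1}(x)=\inf\{y\in[0,\infty)\mid f(y)\le x\}$ denote the generalized inverse ($\inf\emptyset=\infty$). The mass-specific phase field cost $z(\phi)=g^{-1}(\phi^{3/2})$ satisfies $g(s)=(z^{-1}(s))^{3/2}$ for all $s\ge0$, and the corresponding phase field cost $c(\phi)=\phi\,z(\phi)$ (with $0\cdot\infty=0$) is given by $c(0)=0$ and $$c(\phi)=\phi\Big[\frac1K\phi^{3/2}\Big]^{-2\frac{1-\alpha}{1+\alpha}}=K^{2\frac{1-\alpha}{1+\alpha}}\,\phi^{2\frac{2\alpha-1}{1+\alpha}}\qquad(\phi>0).$$ This $c:[0,\infty)\to[0,\infty)$ solves the inverse problem for $\tau$: for all $w\ge0$, $$w^\alpha=\inf\Big\{\int_{\mathbb R}\tfrac12|\psi'(y)|^2+c(|\psi(y)|)\,dy\;\Big|\;\int_{\mathbb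 R}\psi\,dy=w\Big\},$$ where the infimum is over all locally absolutely continuous, integrable $\psi:\mathbb R\to\mathbb R$ with integral $w$. -/

import Mathlib

open scoped NNReal ENNReal
open MeasureTheory

namespace PhaseField

/-- A transport cost `τ : [0,∞) → [0,∞)` is admissible if it is nondecreasing, concave and
continuous with `τ 0 = 0`. -/
structure IsAdmissible (τ : ℝ≥0 → ℝ≥0) : Prop where
  monotone : Monotone τ
  concave : ConcaveOn ℝ≥0 Set.univ τ
  continuous : Continuous τ
  map_zero : τ 0 = 0

/-- `ψ : ℝ → ℝ` is absolutely continuous on every bounded interval, i.e. it is the continuous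
representative of a function in `W^{1,1}_loc(ℝ)`; its weak derivative is then `deriv ψ`, which
exists almost everywhere. -/
def LocallyAbsolutelyContinuous (ψ : ℝ → ℝ) : Prop :=
  ∀ a b : ℝ, AbsolutelyContinuousOnInterval ψ a b

/-- Phase field functions of mass `w`: locally absolutely continuous, integrable, with
integral `w`. -/
def phaseFieldsOfMass (w : ℝ) : Set (ℝ → ℝ) :=
  {ψ | LocallyAbsolutelyContinuous ψ ∧ Integrable ψ ∧ ∫ y, ψ y = w}

/-- The phase field energy `F^c[ψ] = ∫_ℝ ½ |ψ'|² + c(|ψ|) dy`, with values in `[0,∞]`. -/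
noncomputable def phaseFieldEnergy (c : ℝ≥0 → ℝ≥0) (ψ : ℝ → ℝ) : ℝ≥0∞ :=
  ∫⁻ y, (ENNReal.ofReal (1 / 2 * |deriv ψ y| ^ 2) + (c ‖ψ y‖₊ : ℝ≥0∞))

/-- `c` solves the inverse problem for `τ`: `τ(w) = inf {F^c[ψ] | ∫ ψ = w}` for all `w ≥ 0`. -/
def SolvesInverseProblem (τ c : ℝ≥0 → ℝ≥0) : Prop :=
  ∀ w : ℝ≥0, (τ w : ℝ≥0∞) = sInf (phaseFieldEnergy c '' phaseFieldsOfMass w)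

/-- The extension of `τ` to `ℝ` by `-∞` on `(-∞,0)`. -/
noncomputable def extendByBot (τ : ℝ≥0 → ℝ≥0) (w : ℝ) : EReal :=
  if 0 ≤ w then ((τ w.toNNReal : ℝ) : EReal) else ⊥

/-- The Legendre–Fenchel conjugate `f*(t) = sup_x (t x - f(x))` of `f : ℝ → [-∞,∞]`. -/
noncomputable def legendreFenchel (f : ℝ → EReal) (t : ℝ) : EReal :=
  ⨆ x : ℝ, ((t * x : ℝ) : EReal) - f x

/-- The function `[-τ(-·)]*`, where `τ` is extended by `-∞` on `(-∞,0)`. -/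
noncomputable def costConjugate (τ : ℝ≥0 → ℝ≥0) (t : ℝ) : EReal :=
  legendreFenchel (fun x => -extendByBot τ (-x)) t

/-- The convolution kernel: `r(s) = 2√2 / (3 √(-s))` if `s < 0`, and `0` otherwise. -/
noncomputable def kernelR (s : ℝ) : ℝ≥0∞ :=
  if s < 0 then ENNReal.ofReal (2 * √2 / (3 * √(-s))) else 0

/-- The extension of `g : [0,∞) → [0,∞]` to `ℝ` by `0`. (For `t ≥ 0` the values of an extension
on `(-∞,0)` do not enter `[g * r](t)`, since `r` vanishes on `[0,∞)`.) -/
noncomputable def extendByZero (g : ℝ≥0 → ℝ≥0∞) (s : ℝ) : ℝ≥0∞ :=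
  if 0 ≤ s then g s.toNNReal else 0

/-- `g` solves the deconvolution problem for `τ`: `[-τ(-·)]*(t) = [g * r](t)` for all `t ≥ 0`,
where `[g * r](t) = ∫_ℝ g(s) r(t - s) ds` (as an identity in `[-∞,∞]`). -/
def SolvesDeconvolution (τ : ℝ≥0 → ℝ≥0) (g : ℝ≥0 → ℝ≥0∞) : Prop :=
  ∀ t : ℝ≥0, costConjugate τ t =
    ((lconvolution (extendByZero g) kernelR volume (t : ℝ) : ℝ≥0∞) : EReal)

/-- The generalized inverse `z⁻¹(x) = inf {y ∈ [0,∞) | z(y) ≤ x}`, with `inf ∅ = ∞`. -/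
noncomputable def genInv (z : ℝ≥0 → ℝ≥0∞) (x : ℝ≥0) : ℝ≥0∞ :=
  ⨅ (y : ℝ≥0) (_ : z y ≤ x), (y : ℝ≥0∞)

end PhaseField

namespace PhaseField

open Set ProbabilityTheory

/-! Write a = α/(1-α), p = 3/(2a+1) and κ = K^(1/β). Every object is then a power: z(φ) = κ φ^(-p),
c(φ) = κ φ^(1-p), and β = a + 1/2. Both the deconvolution problem and the inverse problem reduce to
Beta integrals and to the single identity K · (2√2/3) · B(a, 1/2) = (1-α) α^a (`const_mul_beta_eq`).

Lower bound (`rpow_le_phaseFieldEnergy`): let W = ∫|ψ| ≥ w and let l be a multiplier with l|ψ| ≤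
c(|ψ|). Split c = lφ + (c - lφ). The first term contributes lW. By Young's inequality the rest,
together with the gradient term, is at least ∫ √(2(c - lφ)) |ψ'|. Since |ψ| rises to any attained
level m and falls again, this is at least 2 ∫_0^m √(2(c(x) - lx)) dx. For l = κ m^(-p) that number
is the conjugate of τ at l, which is the deconvolution identity after the substitution x = z⁻¹(s)
and an integration by parts. The tangent inequality W^α ≤ τ*(l) + lW concludes. As the supremum of
|ψ| need not be attained, or finite, l is only approximately κ m^(-p).

Upper bound (`exists_optimal_phaseField`): equality requires ½ψ'² = c(ψ) - lψ with l = τ'(w). In a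
suitable parameter v this is solved by ψ = M(1-v²)^(1/p), with dy = d(1-v²)^((a-1)/3) dv. Mass and
energy are again Beta integrals. -/

/-! ### Tangent lines and the conjugate of the power cost. -/

/-- This is α u^(α-1) = t, multiplied by u, for u = (t/α)^(1/(α-1)): the point where the power has
slope t. -/
theorem rpow_conjugate_exponent {α t : ℝ} (hα₀ : 0 < α) (hα₁ : α < 1) (ht : 0 < t) :
    (t / α) ^ (α / (α - 1)) * α = t * (t / α) ^ (1 / (α - 1)) := by
  have h1 : α - 1 ≠ 0 := by linarith
  have : α / (α - 1) = 1 + 1 / (α - 1) := by field_simp; ring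
  rw [this, Real.rpow_add (by positivity), Real.rpow_one]
  field_simp

/-- The concave function `w ↦ w ^ α` lies below its tangent of slope `t`. -/
theorem rpow_le_tangent {α t w : ℝ} (hα₀ : 0 < α) (hα₁ : α < 1) (ht : 0 < t) (hw : 0 ≤ w) :
    w ^ α ≤ (1 - α) * (t / α) ^ (α / (α - 1)) + t * w := by
  have key := rpow_conjugate_exponent hα₀ hα₁ ht
  set u := (t / α) ^ (1 / (α - 1)) with hu
  have hu0 : 0 < u := by positivity
  have hua : u ^ α = (t / α) ^ (α / (α - 1)) := by
    rw [hu, ← Real.rpow_mul (by positivity)]; congr 1; ring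
  rw [← hua] at key ⊢
  -- Concavity enters as Bernoulli's inequality at w/u, which is then scaled by u^α.
  have h := rpow_one_add_le_one_add_mul_self (s := w / u - 1) (p := α)
    (by have : 0 ≤ w / u := by positivity
        linarith) hα₀.le hα₁.le
  rw [add_sub_cancel, Real.div_rpow hw hu0.le, div_le_iff₀ (by positivity)] at h
  calc w ^ α ≤ (1 + α * (w / u - 1)) * u ^ α := h
    _ = (1 - α) * u ^ α + (u ^ α * α) / u * w := by field_simp; ring
    _ = _ := by rw [key]; field_simp

theorem tangent_eq {α t : ℝ} (hα₀ : 0 < α) (hα₁ : α < 1) (ht : 0 < t) :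
    ((t / α) ^ (1 / (α - 1))) ^ α =
      (1 - α) * (t / α) ^ (α / (α - 1)) + t * (t / α) ^ (1 / (α - 1)) := by
  rw [← rpow_conjugate_exponent hα₀ hα₁ ht, ← Real.rpow_mul (by positivity), one_div_mul_eq_div]
  ring

section Conjugate

variable {α : ℝ} {τ : ℝ≥0 → ℝ≥0}

theorem isAdmissible_rpow (hα₀ : 0 < α) (hα₁ : α < 1) (hτ : ∀ w, τ w = w ^ α) :
    IsAdmissible τ := by
  have : τ = fun w => w ^ α := funext hτ
  subst this
  refine ⟨NNReal.monotone_rpow_of_nonneg hα₀.le, NNReal.concaveOn_rpow hα₀.le hα₁.le,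
    NNReal.continuous_rpow_const hα₀.le, NNReal.zero_rpow hα₀.ne'⟩

theorem le_costConjugate (τ : ℝ≥0 → ℝ≥0) (t : ℝ) (w : ℝ≥0) :
    (((τ w : ℝ) - t * w : ℝ) : EReal) ≤ costConjugate τ t := by
  refine le_trans (le_of_eq ?_) (le_iSup _ (-(w : ℝ)))
  simp only [extendByBot, neg_neg, NNReal.coe_nonneg, if_true, Real.toNNReal_coe]
  rw [← EReal.coe_neg, ← EReal.coe_sub]
  congr 1
  ring

theorem costConjugate_le {τ : ℝ≥0 → ℝ≥0} {t b : ℝ} (h : ∀ w : ℝ≥0, (τ w : ℝ) - t * w ≤ b) :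
    costConjugate τ t ≤ (b : EReal) := by
  refine iSup_le fun x => ?_
  by_cases hx : 0 ≤ -x
  · have := h (-x).toNNReal
    rw [Real.coe_toNNReal _ hx] at this
    simp only [extendByBot, if_pos hx]
    rw [← EReal.coe_neg, ← EReal.coe_sub, EReal.coe_le_coe_iff]
    linarith
  · simp only [extendByBot, if_neg hx]
    simp

theorem costConjugate_rpow_zero (hα₀ : 0 < α) (hτ : ∀ w, τ w = w ^ α) :
    costConjugate τ 0 = ⊤ := by
  rw [EReal.eq_top_iff_forall_lt]
  intro y
  -- The witness is chosen so that `τ` takes the value |y| + 1 there.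
  refine lt_of_lt_of_le ?_ (le_costConjugate τ 0 ((‖y‖₊ + 1) ^ (1 / α)))
  rw [EReal.coe_lt_coe_iff, hτ, ← NNReal.rpow_mul, one_div_mul_cancel hα₀.ne', NNReal.rpow_one]
  simp only [zero_mul, sub_zero, NNReal.coe_add, coe_nnnorm, NNReal.coe_one]
  exact (Real.le_norm_self y).trans_lt (lt_add_one _)

theorem costConjugate_rpow (hα₀ : 0 < α) (hα₁ : α < 1) (hτ : ∀ w, τ w = w ^ α) {t : ℝ}
    (ht : 0 < t) :
    costConjugate τ t = (((1 - α) * (t / α) ^ (α / (α - 1)) : ℝ) : EReal) := by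
  apply le_antisymm
  · refine costConjugate_le fun w => ?_
    rw [hτ, NNReal.coe_rpow]
    linarith [rpow_le_tangent hα₀ hα₁ ht w.coe_nonneg]
  · refine le_trans (le_of_eq ?_) (le_costConjugate τ t ((t / α) ^ (1 / (α - 1))).toNNReal)
    rw [hτ, NNReal.coe_rpow, Real.coe_toNNReal _ (by positivity), tangent_eq hα₀ hα₁ ht]
    congr 1
    ring

end Conjugate

/-! ### Generalized inverses of powers and Beta integrals. -/

/-- The generalized inverse of the power function `s ↦ A * s ^ (-b)`. -/
theorem genInv_const_mul_rpow {A : ℝ≥0∞} {b : ℝ} (hA₀ : A ≠ 0) (hA : A ≠ ⊤) (hb : 0 < b)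
    {f : ℝ≥0 → ℝ≥0∞} (hf : ∀ s, f s = A * (s : ℝ≥0∞) ^ (-b)) (x : ℝ≥0) :
    genInv f x = A ^ (1 / b) * (x : ℝ≥0∞) ^ (-(1 / b)) := by
  have hb' : 0 < 1 / b := by positivity
  -- The admissible `y` form a ray; for x = 0 its endpoint is ∞ and the ray is empty.
  have key : ∀ y : ℝ≥0, f y ≤ x ↔ A ^ (1 / b) * (x : ℝ≥0∞) ^ (-(1 / b)) ≤ y := by
    intro y
    rw [hf, ← ENNReal.rpow_le_rpow_iff hb', ENNReal.mul_rpow_of_nonneg _ _ hb'.le,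
      ← ENNReal.rpow_mul, ENNReal.rpow_neg, show -b * (1 / b) = -1 by field_simp,
      ENNReal.rpow_neg_one, ← div_eq_mul_inv, ← div_eq_mul_inv]
    have hAb : A ^ (1 / b) ≠ 0 := by simp [hA₀, hA]
    rw [ENNReal.div_le_iff_le_mul (Or.inr (by simp [hb.le])) (Or.inl (by simp)),
      ENNReal.div_le_iff_le_mul (Or.inr (by simp)) (Or.inl (by simp [hb.le])), mul_comm]
  refine le_antisymm ?_ (le_iInf₂ fun y hy => (key y).1 hy)
  refine ENNReal.le_of_forall_nnreal_lt fun r hr => ?_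
  rw [genInv] at hr
  by_contra hlt
  rw [not_le] at hlt
  exact absurd hr (not_lt.2 (iInf₂_le r ((key r).2 hlt.le)))

/-- The Beta density has total mass one. -/
theorem lintegral_beta {a b : ℝ} (ha : 0 < a) (hb : 0 < b) :
    ∫⁻ x in Ioo (0 : ℝ) 1, ENNReal.ofReal (x ^ (a - 1) * (1 - x) ^ (b - 1)) =
      ENNReal.ofReal (beta a b) := by
  have hpos := beta_pos ha hb
  have h := lintegral_betaPDF_eq_one ha hb
  rw [lintegral_betaPDF] at h
  simp_rw [mul_assoc, ENNReal.ofReal_mul (one_div_pos.2 hpos).le] at h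
  rw [lintegral_const_mul' _ _ ENNReal.ofReal_ne_top] at h
  calc _ = ENNReal.ofReal (beta a b) * (ENNReal.ofReal (1 / beta a b) *
      ∫⁻ x in Ioo (0 : ℝ) 1, ENNReal.ofReal (x ^ (a - 1) * (1 - x) ^ (b - 1))) := by
        rw [← mul_assoc, ← ENNReal.ofReal_mul hpos.le, mul_one_div_cancel hpos.ne']; simp
    _ = _ := by rw [h, mul_one]

/-- Substituting `v² = x` on either half of `(-1,1)`. -/
theorem lintegral_one_sub_sq_rpow {a : ℝ} (ha : 0 < a) :
    ∫⁻ v in Ioo (-1 : ℝ) 1, ENNReal.ofReal ((1 - v ^ 2) ^ (a - 1)) =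
      ENNReal.ofReal (beta (1 / 2) a) := by
  set f : ℝ → ℝ≥0∞ := fun v => ENNReal.ofReal ((1 - v ^ 2) ^ (a - 1)) with hf
  have half : ∀ σ : ℝ, |σ| = 1 →
      ∫⁻ v in (fun x => σ * √x) '' Ioo (0 : ℝ) 1, f v = ENNReal.ofReal (beta (1 / 2) a / 2) := by
    intro σ hσ
    have hσ2 : σ ^ 2 = 1 := by rw [← sq_abs, hσ, one_pow]
    have hσ0 : σ ≠ 0 := by rintro rfl; simp at hσ
    rw [lintegral_image_eq_lintegral_abs_deriv_mul (f' := fun x => σ * (1 / (2 * √x)))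
      measurableSet_Ioo]
    · have : ∀ x ∈ Ioo (0 : ℝ) 1, ENNReal.ofReal |σ * (1 / (2 * √x))| * f (σ * √x) =
          ENNReal.ofReal (1 / 2) * ENNReal.ofReal (x ^ ((1 / 2 : ℝ) - 1) * (1 - x) ^ (a - 1)) := by
        intro x hx
        have hx0 : 0 < √x := Real.sqrt_pos.2 hx.1
        rw [hf, abs_mul, hσ, one_mul, abs_of_pos (by positivity),
          ← ENNReal.ofReal_mul (by positivity), ← ENNReal.ofReal_mul (by positivity), mul_pow, hσ2,
          one_mul, Real.sq_sqrt hx.1.le]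
        congr 1
        rw [show (1 / 2 : ℝ) - 1 = -(1 / 2) by norm_num, Real.rpow_neg hx.1.le,
          ← Real.sqrt_eq_rpow]
        field_simp
      rw [setLIntegral_congr_fun measurableSet_Ioo this, lintegral_const_mul' _ _ (by simp),
        lintegral_beta (by norm_num) ha, ← ENNReal.ofReal_mul (by norm_num)]
      congr 1; ring
    · intro x hx
      exact ((Real.hasDerivAt_sqrt hx.1.ne').const_mul σ).hasDerivWithinAt
    · intro x hx y hy hxy
      exact (Real.sqrt_inj hx.1.le hy.1.le).1 (mul_left_cancel₀ hσ0 hxy)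
  have im1 : (fun x => (1 : ℝ) * √x) '' Ioo (0 : ℝ) 1 = Ioo 0 1 := by
    ext v
    constructor
    · rintro ⟨x, hx, rfl⟩
      simp only [one_mul]
      exact ⟨Real.sqrt_pos.2 hx.1, by rw [Real.sqrt_lt' one_pos]; simpa using hx.2⟩
    · intro hv
      exact ⟨v ^ 2, ⟨by have := hv.1; positivity, by nlinarith [hv.1, hv.2]⟩,
        by simp [Real.sqrt_sq hv.1.le]⟩
  have im2 : (fun x => (-1 : ℝ) * √x) '' Ioo (0 : ℝ) 1 = Ioo (-1) 0 := by
    ext v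
    constructor
    · rintro ⟨x, hx, rfl⟩
      have h1 : 0 < √x := Real.sqrt_pos.2 hx.1
      have h2 : √x < 1 := by rw [Real.sqrt_lt' one_pos]; simpa using hx.2
      constructor <;> simp only [] <;> linarith
    · intro hv
      refine ⟨v ^ 2, ⟨by nlinarith [hv.2], by nlinarith [hv.1, hv.2]⟩, ?_⟩
      have : √(v ^ 2) = -v := by rw [Real.sqrt_sq_eq_abs, abs_of_neg hv.2]
      simp [this]
  have h1 := half 1 (by simp)
  have h2 := half (-1) (by simp)
  rw [im1] at h1
  rw [im2] at h2
  have hae : (Ioo (-1 : ℝ) 1 : Set ℝ) = Ioo (-1) 0 ∪ Ico 0 1 :=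
    (Ioo_union_Ico_eq_Ioo (by norm_num) (by norm_num)).symm
  rw [hae, lintegral_union measurableSet_Ico (by
    rw [Set.disjoint_left]; intro x hx hx'; exact absurd hx'.1 (not_le.2 hx.2)),
    setLIntegral_congr Ioo_ae_eq_Ico.symm, h1, h2,
    ← ENNReal.ofReal_add (by have := beta_pos one_half_pos ha; positivity)
      (by have := beta_pos one_half_pos ha; positivity), add_halves]

theorem beta_succ {a : ℝ} (ha : 0 < a) :
    beta (1 / 2) (a + 1) * (2 * a + 1) = 2 * a * beta (1 / 2) a := by
  have h1 : Real.Gamma (1 / 2 + a) ≠ 0 := (Real.Gamma_pos_of_pos (by positivity)).ne'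
  rw [beta, beta, Real.Gamma_add_one ha.ne', ← add_assoc, Real.Gamma_add_one (by positivity)]
  field_simp
  ring

/-! ### The deconvolution problem. -/

section Deconvolution

variable {α β K a : ℝ}

theorem one_add_div_one_sub (hα₁ : α < 1) : 1 / (1 - α) = α / (1 - α) + 1 := by
  have : 1 - α ≠ 0 := by linarith
  field_simp
  ring

theorem deconvolution_constant (hα₀ : 0 < α) (hα₁ : α < 1) (ha : a = α / (1 - α))
    (hβ : β = 1 / 2 + a)
    (hK : K = (1 - α) / α * α ^ (1 / (1 - α)) * ((2 * β - 1) / (2 * √(2 * Real.pi)))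
      * (3 * Real.Gamma β / (2 * Real.Gamma (β + 1 / 2)))) :
    K = α ^ (a + 1) * (1 / √(2 * Real.pi)) * (3 * Real.Gamma β / (2 * Real.Gamma (a + 1))) := by
  have h1 : 1 - α ≠ 0 := by linarith
  have h2 : 2 * β - 1 = 2 * α / (1 - α) := by rw [hβ, ha]; ring
  have h3 : β + 1 / 2 = a + 1 := by rw [hβ]; ring
  have h4 : Real.Gamma (a + 1) ≠ 0 :=
    (Real.Gamma_pos_of_pos (by have : 0 < 1 - α := by linarith
                               rw [ha]; positivity)).ne'
  have h5 : √(2 * Real.pi) ≠ 0 := by positivity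
  rw [hK, h2, h3, one_add_div_one_sub hα₁, ← ha]
  field_simp

/-- The factor Γ(β) in `K` cancels the denominator of B(a, 1/2) because β = a + 1/2. The value of
`K` enters both problems only through this identity. -/
theorem const_mul_beta_eq (hα₀ : 0 < α) (hα₁ : α < 1) (ha : a = α / (1 - α)) (hβ : β = 1 / 2 + a)
    (hK : K = α ^ (a + 1) * (1 / √(2 * Real.pi)) *
      (3 * Real.Gamma β / (2 * Real.Gamma (a + 1)))) :
    K * (2 * √2 / 3) * beta a (1 / 2) = (1 - α) * α ^ a := by
  have h1 : 0 < 1 - α := by linarith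
  have ha0 : 0 < a := by rw [ha]; positivity
  have h2 : Real.Gamma a ≠ 0 := (Real.Gamma_pos_of_pos ha0).ne'
  have h3 : Real.Gamma (a + 1 / 2) ≠ 0 := (Real.Gamma_pos_of_pos (by positivity)).ne'
  have h4 : α = a * (1 - α) := by rw [ha]; field_simp
  have h5 : √Real.pi ≠ 0 := by positivity
  rw [hK, hβ, beta, Real.Gamma_one_half_eq, add_comm (1 / 2) a, Real.Gamma_add_one ha0.ne',
    Real.rpow_add_one hα₀.ne', Real.sqrt_mul (by norm_num)]
  field_simp
  linarith

theorem image_const_div_Ioo {t : ℝ} (ht : 0 < t) :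
    (fun x => t * x⁻¹) '' Ioo (0 : ℝ) 1 = Ioi t := by
  ext s
  constructor
  · rintro ⟨x, hx, rfl⟩
    have : 1 < x⁻¹ := (one_lt_inv₀ hx.1).2 hx.2
    simp only [mem_Ioi]
    nlinarith
  · intro hs
    have hs' : t < s := hs
    have hs0 : 0 < s := ht.trans hs'
    refine ⟨t / s, ⟨by positivity, (div_lt_one hs0).2 hs'⟩, ?_⟩
    simp only []
    field_simp

theorem lconvolution_kernelR {g : ℝ≥0 → ℝ≥0∞} (hK : 0 < K)
    (hg : ∀ s, g s = ENNReal.ofReal K * (s : ℝ≥0∞) ^ (-β)) {t : ℝ} (ht : 0 ≤ t) :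
    lconvolution (extendByZero g) kernelR volume t =
      ∫⁻ s in Ioi t, ENNReal.ofReal (K * s ^ (-β) * (2 * √2 / (3 * √(s - t)))) := by
  rw [lconvolution, ← lintegral_indicator measurableSet_Ioi]
  refine lintegral_congr fun s => ?_
  by_cases hs : t < s
  · have hs0 : 0 < s := ht.trans_lt hs
    rw [indicator_of_mem (mem_Ioi.2 hs), extendByZero, if_pos hs0.le, kernelR,
      if_pos (by linarith), hg, show -(-s + t) = s - t by ring,
      ENNReal.ofReal_mul (by positivity), ENNReal.ofReal_mul hK.le]
    congr 2
    rw [← ENNReal.ofReal_rpow_of_pos hs0]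
    rfl
  · rw [indicator_of_notMem (by simpa using hs), kernelR, if_neg (by linarith), mul_zero]

/-- The substitution s = t/x maps (t, ∞) to (0, 1) and yields the Beta integrand x^(a-1)
(1-x)^(-1/2). -/
theorem lconvolution_kernelR_pos {g : ℝ≥0 → ℝ≥0∞} (hK : 0 < K) (ha : 0 < a) (hβ : β = 1 / 2 + a)
    (hg : ∀ s, g s = ENNReal.ofReal K * (s : ℝ≥0∞) ^ (-β)) {t : ℝ} (ht : 0 < t) :
    lconvolution (extendByZero g) kernelR volume t =
      ENNReal.ofReal (K * (2 * √2 / 3) * t ^ (-a) * beta a (1 / 2)) := by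
  rw [lconvolution_kernelR hK hg ht.le, ← image_const_div_Ioo ht,
    lintegral_image_eq_lintegral_abs_deriv_mul (f' := fun x => t * (-(x ^ 2)⁻¹))
      measurableSet_Ioo]
  · have : ∀ x ∈ Ioo (0 : ℝ) 1, ENNReal.ofReal |t * (-(x ^ 2)⁻¹)| *
        ENNReal.ofReal (K * (t * x⁻¹) ^ (-β) * (2 * √2 / (3 * √(t * x⁻¹ - t)))) =
        ENNReal.ofReal (K * (2 * √2 / 3) * t ^ (-a)) *
          ENNReal.ofReal (x ^ (a - 1) * (1 - x) ^ ((1 / 2 : ℝ) - 1)) := by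
      intro x ⟨hx0, hx1⟩
      have h1x : 0 < 1 - x := by linarith
      rw [← ENNReal.ofReal_mul (by positivity), ← ENNReal.ofReal_mul (by positivity)]
      congr 1
      have e1 : √(t * x⁻¹ - t) = √t * √(1 - x) / √x := by
        rw [← Real.sqrt_mul ht.le, ← Real.sqrt_div (by positivity)]
        congr 1
        field_simp
      have e2 : (1 - x) ^ ((1 / 2 : ℝ) - 1) = (√(1 - x))⁻¹ := by
        rw [show (1 / 2 : ℝ) - 1 = -(1 / 2) by norm_num, Real.rpow_neg h1x.le,
          ← Real.sqrt_eq_rpow]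
      have e3 : x ^ (a - 1) = x ^ β * √x / x ^ 2 := by
        rw [hβ, Real.sqrt_eq_rpow, ← Real.rpow_natCast, ← Real.rpow_add hx0, ← Real.rpow_sub hx0]
        congr 1
        push_cast
        ring
      have e4 : t ^ (-a) = t ^ (-β) * t / √t := by
        rw [hβ, Real.sqrt_eq_rpow, ← Real.rpow_add_one ht.ne', ← Real.rpow_sub ht]
        congr 1
        ring
      rw [e1, e2, e3, e4, abs_mul, abs_neg, abs_of_pos ht, abs_of_pos (by positivity),
        Real.mul_rpow ht.le (by positivity), Real.inv_rpow hx0.le, Real.rpow_neg hx0.le, inv_inv]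
      have := Real.sqrt_pos.2 h1x
      have := Real.sqrt_pos.2 hx0
      have := Real.sqrt_pos.2 ht
      field_simp
    rw [setLIntegral_congr_fun measurableSet_Ioo this, lintegral_const_mul' _ _ (by simp),
      lintegral_beta ha one_half_pos, ← ENNReal.ofReal_mul (by positivity)]
  · intro x hx
    exact ((hasDerivAt_inv hx.1.ne').const_mul t).hasDerivWithinAt
  · intro x hx y hy hxy
    exact inv_injective (mul_left_cancel₀ ht.ne' hxy)

theorem lconvolution_kernelR_zero {g : ℝ≥0 → ℝ≥0∞} (hK : 0 < K)
    (hg : ∀ s, g s = ENNReal.ofReal K * (s : ℝ≥0∞) ^ (-β)) :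
    lconvolution (extendByZero g) kernelR volume 0 = ⊤ := by
  rw [lconvolution_kernelR hK hg le_rfl]
  by_contra h
  -- At t = 0 the integrand is a multiple of s^(-β-1/2), and no power is integrable on the whole
  -- half-line.
  refine not_integrableOn_Ioi_rpow (-β - 1 / 2) ?_
  have hc : 0 < K * (2 * √2 / 3) := by positivity
  have hm : Measurable fun s : ℝ => K * s ^ (-β) * (2 * √2 / (3 * √(s - 0))) := by fun_prop
  have hi : IntegrableOn (fun s : ℝ => K * s ^ (-β) * (2 * √2 / (3 * √(s - 0)))) (Ioi 0) := by
    refine ⟨hm.aestronglyMeasurable, ?_⟩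
    rw [hasFiniteIntegral_iff_ofReal]
    · exact lt_top_iff_ne_top.2 h
    · refine (ae_restrict_iff' measurableSet_Ioi).2 (.of_forall fun s hs => ?_)
      have : (0 : ℝ) < s := hs
      positivity
  refine IntegrableOn.congr_fun (hi.const_mul (K * (2 * √2 / 3))⁻¹) (fun s hs => ?_)
    measurableSet_Ioi
  have hs0 : (0 : ℝ) < s := hs
  have := Real.sqrt_pos.2 hs0
  rw [Real.rpow_sub hs0, ← Real.sqrt_eq_rpow, sub_zero]
  field_simp

theorem solvesDeconvolution_rpow {τ : ℝ≥0 → ℝ≥0} {g : ℝ≥0 → ℝ≥0∞} (hα₀ : 0 < α) (hα₁ : α < 1)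
    (ha : a = α / (1 - α)) (hβ : β = 1 / 2 + a) (hK₀ : 0 < K)
    (hK : K * (2 * √2 / 3) * beta a (1 / 2) = (1 - α) * α ^ a) (hτ : ∀ w, τ w = w ^ α)
    (hg : ∀ s, g s = ENNReal.ofReal K * (s : ℝ≥0∞) ^ (-β)) :
    SolvesDeconvolution τ g := by
  intro t
  have h1 : 0 < 1 - α := by linarith
  have ha0 : 0 < a := by rw [ha]; positivity
  rcases eq_zero_or_pos t with rfl | ht
  · rw [NNReal.coe_zero, costConjugate_rpow_zero hα₀ hτ, lconvolution_kernelR_zero hK₀ hg]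
    rfl
  · have ht' : (0 : ℝ) < t := ht
    have he : α / (α - 1) = -a := by
      rw [ha, ← div_neg, neg_sub]
    rw [costConjugate_rpow hα₀ hα₁ hτ ht', lconvolution_kernelR_pos hK₀ ha0 hβ hg ht',
      EReal.coe_ennreal_ofReal, max_eq_left]
    · congr 1
      rw [mul_right_comm, hK, he, Real.div_rpow ht'.le hα₀.le, Real.rpow_neg hα₀.le, div_inv_eq_mul]
      ring
    · have := beta_pos ha0 one_half_pos
      positivity

end Deconvolution

/-! ### Chain rule for absolutely continuous functions. -/

section AbsolutelyContinuous

theorem _root_.LipschitzOnWith.comp_absolutelyContinuousOnInterval {H ψ : ℝ → ℝ} {a b : ℝ}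
    {C : ℝ≥0} {s : Set ℝ} (hH : LipschitzOnWith C H s) (hψ : AbsolutelyContinuousOnInterval ψ a b)
    (hs : MapsTo ψ (uIcc a b) s) : AbsolutelyContinuousOnInterval (fun x => H (ψ x)) a b := by
  rw [absolutelyContinuousOnInterval_iff] at hψ ⊢
  intro ε hε
  obtain ⟨δ, hδ, h⟩ := hψ (ε / (C + 1)) (by positivity)
  refine ⟨δ, hδ, fun E hE hsum => ?_⟩
  have h1 := h E hE hsum
  rw [lt_div_iff₀ (by positivity)] at h1
  refine lt_of_le_of_lt ?_ h1
  rw [Finset.sum_mul]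
  refine Finset.sum_le_sum fun i hi => ?_
  have hm := hE.1 i hi
  refine (hH.dist_le_mul _ (hs hm.1) _ (hs hm.2)).trans ?_
  nlinarith [dist_nonneg (x := ψ (E.2 i).1) (y := ψ (E.2 i).2)]

/-- An antiderivative H of `h` is Lipschitz on the bounded range of `ψ`, so H ∘ ψ is absolutely
continuous. The integral is its increment, hence the integral of h(ψ)ψ'. -/
theorem ofReal_abs_integral_le_lintegral {ψ h : ℝ → ℝ} {a b : ℝ} (hab : a ≤ b)
    (hψ : AbsolutelyContinuousOnInterval ψ a b) (hh : Continuous h) (hh0 : ∀ x, 0 ≤ h x) :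
    ENNReal.ofReal |∫ x in ψ a..ψ b, h x| ≤
      ∫⁻ y in Ioc a b, ENNReal.ofReal (h (ψ y) * |deriv ψ y|) := by
  set H : ℝ → ℝ := fun x => ∫ t in (0 : ℝ)..x, h t with hHdef
  have hH : ∀ x, HasDerivAt H (h x) x := fun x =>
    intervalIntegral.integral_hasDerivAt_right (hh.intervalIntegrable _ _)
      (hh.stronglyMeasurableAtFilter _ _) hh.continuousAt
  have hHC : ContDiff ℝ 1 H := by
    rw [contDiff_one_iff_deriv]
    refine ⟨fun x => (hH x).differentiableAt, ?_⟩
    rwa [show deriv H = h from funext fun x => (hH x).deriv]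
  obtain ⟨B, hB⟩ := hψ.exists_bound
  obtain ⟨C, hC⟩ := hHC.contDiffOn.exists_lipschitzOnWith (s := Icc (-B) B) one_ne_zero
    (convex_Icc _ _) isCompact_Icc
  have hAC := hC.comp_absolutelyContinuousOnInterval hψ fun x hx => abs_le.1 (hB x hx)
  have hint := hAC.integral_deriv_eq_sub
  have hval : ∫ x in ψ a..ψ b, h x = ∫ x in a..b, deriv (fun x => H (ψ x)) x := by
    rw [hint, hHdef]
    exact (intervalIntegral.integral_interval_sub_left (hh.intervalIntegrable _ _)
      (hh.intervalIntegrable _ _)).symm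
  rw [hval, intervalIntegral.integral_of_le hab, ← Real.enorm_eq_ofReal_abs]
  refine (enorm_integral_le_lintegral_enorm _).trans (le_of_eq ?_)
  refine lintegral_congr_ae ?_
  rw [Filter.EventuallyEq, ae_restrict_iff' measurableSet_Ioc]
  filter_upwards [hψ.ae_differentiableAt] with x hx hxm
  have hd := hx (by rw [uIcc_of_le hab]; exact Ioc_subset_Icc_self hxm)
  have := ((hH (ψ x)).comp x hd.hasDerivAt).deriv
  rw [Function.comp_def] at this
  rw [this, Real.enorm_eq_ofReal_abs, abs_mul, abs_of_nonneg (hh0 _)]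

end AbsolutelyContinuous

/-! ### The Modica–Mortola lower bound. -/

section LowerBound

/-- Integrability forbids ψ > ε on a whole half-line, so the level is crossed; y₁ is the last
crossing before y₀. -/
theorem exists_left_level {ψ : ℝ → ℝ} (hc : Continuous ψ) (hi : Integrable ψ) {y₀ ε : ℝ}
    (hε : 0 < ε) (hy₀ : ε < ψ y₀) : ∃ y₁ < y₀, ψ y₁ = ε ∧ ∀ y ∈ Icc y₁ y₀, ε ≤ ψ y := by
  obtain ⟨y, hy, hyε⟩ : ∃ y ≤ y₀, ψ y ≤ ε := by
    by_contra! h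
    have h1 : IntegrableOn (fun _ : ℝ => ε) (Iic y₀) := by
      refine Integrable.mono' hi.integrableOn (by fun_prop) ?_
      refine (ae_restrict_iff' measurableSet_Iic).2 (.of_forall fun y hy => ?_)
      rw [Real.norm_of_nonneg hε.le]
      exact (h y hy).le
    rw [integrableOn_const_iff] at h1
    simp [hε.ne'] at h1
  have hcomp : IsCompact (Icc y y₀ ∩ ψ ⁻¹' {ε}) :=
    isCompact_Icc.inter_right (isClosed_singleton.preimage hc)
  have hne : (Icc y y₀ ∩ ψ ⁻¹' {ε}).Nonempty := by
    obtain ⟨x, hx, hxε⟩ := intermediate_value_Icc hy hc.continuousOn ⟨hyε, hy₀.le⟩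
    exact ⟨x, hx, hxε⟩
  obtain ⟨y₁, hy₁, hmax⟩ := hcomp.exists_isGreatest hne
  have hψ₁ : ψ y₁ = ε := hy₁.2
  refine ⟨y₁, lt_of_le_of_ne hy₁.1.2 (by rintro rfl; exact hy₀.ne' hψ₁), hψ₁, fun x hx => ?_⟩
  by_contra! hlt
  -- A dip below `ε` after `y₁` would force a later crossing.
  obtain ⟨x', hx', hxε'⟩ := intermediate_value_Icc hx.2 hc.continuousOn ⟨hlt.le, hy₀.le⟩
  have := hmax ⟨⟨hy₁.1.1.trans (hx.1.trans hx'.1), hx'.2⟩, hxε'⟩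
  have hxx : x = y₁ := le_antisymm (hx'.1.trans this) hx.1
  rw [hxx, hψ₁] at hlt
  exact lt_irrefl _ hlt

theorem exists_right_level {ψ : ℝ → ℝ} (hc : Continuous ψ) (hi : Integrable ψ) {y₀ ε : ℝ}
    (hε : 0 < ε) (hy₀ : ε < ψ y₀) : ∃ y₂ > y₀, ψ y₂ = ε ∧ ∀ y ∈ Icc y₀ y₂, ε ≤ ψ y := by
  obtain ⟨y, hy, hyε, h⟩ := exists_left_level (ψ := fun x => ψ (-x)) (y₀ := -y₀)
    (hc.comp continuous_neg) hi.comp_neg hε (by simpa using hy₀)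
  refine ⟨-y, by linarith, hyε, fun x hx => ?_⟩
  have := h (-x) ⟨by linarith [hx.2], by linarith [hx.1]⟩
  simpa using this

theorem LocallyAbsolutelyContinuous.continuous {ψ : ℝ → ℝ} (h : LocallyAbsolutelyContinuous ψ) :
    Continuous ψ := by
  rw [continuous_iff_continuousAt]
  intro x
  refine (h (x - 1) (x + 1)).continuousOn.continuousAt ?_
  rw [uIcc_of_le (by linarith)]
  exact Icc_mem_nhds (by linarith) (by linarith)

theorem LocallyAbsolutelyContinuous.neg {ψ : ℝ → ℝ} (h : LocallyAbsolutelyContinuous ψ) :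
    LocallyAbsolutelyContinuous (fun y => -ψ y) := fun a b => (h a b).neg

/-- The Modica–Mortola integrand of the potential `c(φ) - lφ`. -/
noncomputable def modicaMortola (c : ℝ≥0 → ℝ≥0) (l x : ℝ) : ℝ :=
  √(2 * ((c x.toNNReal : ℝ) - l * x))

variable {c : ℝ≥0 → ℝ≥0} {ψ : ℝ → ℝ} {l : ℝ}

theorem lintegral_Ioc_le_of_level (hc : ContinuousOn (fun x : ℝ => (c x.toNNReal : ℝ)) (Ioi 0))
    {a b ε m : ℝ} (hab : a ≤ b) (hψ : AbsolutelyContinuousOnInterval ψ a b) (hε : 0 < ε)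
    (hεm : ε ≤ m) (hlev : ∀ y ∈ Icc a b, ε ≤ ψ y)
    (hend : ψ a = ε ∧ m ≤ ψ b ∨ m ≤ ψ a ∧ ψ b = ε) :
    ∫⁻ x in Ioc ε m, ENNReal.ofReal (modicaMortola c l x) ≤
      ∫⁻ y in Ioc a b, ENNReal.ofReal (modicaMortola c l |ψ y| * |deriv ψ y|) := by
  -- The cost may blow up at 0 (it does for α < 1/2). Freezing the integrand below `ε` makes it
  -- continuous and changes nothing where ψ ≥ ε.
  set h : ℝ → ℝ := fun x => modicaMortola c l (max x ε) with hh
  have hcont : Continuous h := by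
    have h1 : ContinuousOn (modicaMortola c l) (Ioi 0) := by
      unfold modicaMortola
      exact (continuousOn_const.mul (hc.sub (by fun_prop))).sqrt
    exact h1.comp_continuous (by fun_prop) fun x => lt_max_of_lt_right hε
  have h0 : ∀ x, 0 ≤ h x := fun x => Real.sqrt_nonneg _
  have key := ofReal_abs_integral_le_lintegral hab hψ hcont h0
  have hR : ∫⁻ y in Ioc a b, ENNReal.ofReal (h (ψ y) * |deriv ψ y|) =
      ∫⁻ y in Ioc a b, ENNReal.ofReal (modicaMortola c l |ψ y| * |deriv ψ y|) := by
    refine setLIntegral_congr_fun measurableSet_Ioc fun y hy => ?_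
    have := hlev y (Ioc_subset_Icc_self hy)
    simp only [hh, max_eq_left this, abs_of_pos (hε.trans_le this)]
  rw [← hR]
  refine le_trans ?_ key
  have hgen : ∀ M, m ≤ M → ∫⁻ x in Ioc ε m, ENNReal.ofReal (modicaMortola c l x) ≤
      ENNReal.ofReal (∫ x in ε..M, h x) := by
    intro M hM
    rw [intervalIntegral.integral_of_le (hεm.trans hM),
      ofReal_integral_eq_lintegral_ofReal (hcont.integrableOn_Ioc) (.of_forall h0)]
    refine le_trans (le_of_eq ?_) (lintegral_mono_set (Ioc_subset_Ioc_right hM))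
    refine setLIntegral_congr_fun measurableSet_Ioc fun x hx => ?_
    simp only [hh, max_eq_left hx.1.le]
  rcases hend with ⟨h1, h2⟩ | ⟨h1, h2⟩
  · rw [h1]
    exact (hgen _ h2).trans (ENNReal.ofReal_le_ofReal (le_abs_self _))
  · rw [h2, intervalIntegral.integral_symm, abs_neg]
    exact (hgen _ h1).trans (ENNReal.ofReal_le_ofReal (le_abs_self _))

/-- The factor 2 counts the ascent to y₀ and the descent from it, over disjoint intervals. -/
theorem two_mul_lintegral_modicaMortola_le_of_pos
    (hc : ContinuousOn (fun x : ℝ => (c x.toNNReal : ℝ)) (Ioi 0))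
    (hψ : LocallyAbsolutelyContinuous ψ) (hi : Integrable ψ) {y₀ ε m : ℝ} (hε : 0 < ε)
    (hεm : ε < m) (hm : m ≤ ψ y₀) :
    2 * ∫⁻ x in Ioc ε m, ENNReal.ofReal (modicaMortola c l x) ≤
      ∫⁻ y, ENNReal.ofReal (modicaMortola c l |ψ y| * |deriv ψ y|) := by
  obtain ⟨y₁, hy₁, hψ₁, hl₁⟩ := exists_left_level hψ.continuous hi hε (hεm.trans_le hm)
  obtain ⟨y₂, hy₂, hψ₂, hl₂⟩ := exists_right_level hψ.continuous hi hε (hεm.trans_le hm)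
  have k1 := lintegral_Ioc_le_of_level (l := l) hc hy₁.le (hψ _ _) hε hεm.le hl₁ (.inl ⟨hψ₁, hm⟩)
  have k2 := lintegral_Ioc_le_of_level (l := l) hc hy₂.le (hψ _ _) hε hεm.le hl₂ (.inr ⟨hm, hψ₂⟩)
  rw [two_mul]
  refine (add_le_add k1 k2).trans ?_
  rw [← lintegral_union measurableSet_Ioc]
  · exact setLIntegral_le_lintegral _ _
  · rw [Set.disjoint_left]
    intro x hx hx'
    exact absurd hx.2 (not_le.2 hx'.1)

theorem two_mul_lintegral_modicaMortola_le
    (hc : ContinuousOn (fun x : ℝ => (c x.toNNReal : ℝ)) (Ioi 0))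
    (hψ : LocallyAbsolutelyContinuous ψ) (hi : Integrable ψ) {y₀ m : ℝ} (hm : m ≤ |ψ y₀|) :
    2 * ∫⁻ x in Ioc 0 m, ENNReal.ofReal (modicaMortola c l x) ≤
      ∫⁻ y, ENNReal.ofReal (modicaMortola c l |ψ y| * |deriv ψ y|) := by
  -- Monotone convergence lets the lower level tend to 0.
  have hU : Ioc 0 m = ⋃ n : ℕ, Ioc (1 / ((n : ℝ) + 1)) m := by
    ext x
    simp only [mem_Ioc, mem_iUnion]
    constructor
    · rintro ⟨h1, h2⟩
      obtain ⟨n, hn⟩ := exists_nat_one_div_lt h1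
      exact ⟨n, hn, h2⟩
    · rintro ⟨n, h1, h2⟩
      exact ⟨lt_trans (by positivity) h1, h2⟩
  have hmono : Monotone fun n : ℕ => Ioc (1 / ((n : ℝ) + 1)) m := fun i j hij =>
    Ioc_subset_Ioc_left (one_div_le_one_div_of_le (by positivity) (by simpa using hij))
  rw [hU, setLIntegral_iUnion_of_directed _ hmono.directed_le, ENNReal.mul_iSup]
  refine iSup_le fun n => ?_
  have hε : (0 : ℝ) < 1 / (n + 1) := by positivity
  rcases le_or_gt m (1 / (n + 1)) with h | h
  · rw [Ioc_eq_empty (not_lt.2 h)]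
    simp
  · rcases le_abs.1 hm with h1 | h1
    · exact two_mul_lintegral_modicaMortola_le_of_pos hc hψ hi hε h h1
    · have := two_mul_lintegral_modicaMortola_le_of_pos (l := l) hc hψ.neg hi.neg hε h h1
      simpa [deriv.fun_neg] using this

/-- The Modica–Mortola lower bound for the phase field energy with a Lagrange multiplier `l`. -/
theorem le_phaseFieldEnergy (hc : ContinuousOn (fun x : ℝ => (c x.toNNReal : ℝ)) (Ioi 0))
    (hψ : LocallyAbsolutelyContinuous ψ) (hi : Integrable ψ) (hl : 0 ≤ l)
    (hlc : ∀ y, l * |ψ y| ≤ c ‖ψ y‖₊) {y₀ m : ℝ} (hm : m ≤ |ψ y₀|) :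
    ENNReal.ofReal (l * ∫ y, |ψ y|) +
      2 * ∫⁻ x in Ioc 0 m, ENNReal.ofReal (modicaMortola c l x) ≤ phaseFieldEnergy c ψ := by
  have h1 : ENNReal.ofReal (l * ∫ y, |ψ y|) = ∫⁻ y, ENNReal.ofReal (l * |ψ y|) := by
    rw [← integral_const_mul, ofReal_integral_eq_lintegral_ofReal (hi.abs.const_mul l)
      (.of_forall fun y => by positivity)]
  rw [h1]
  refine (add_le_add le_rfl (two_mul_lintegral_modicaMortola_le hc hψ hi hm)).trans ?_
  have hcψ := hψ.continuous
  rw [← lintegral_add_left (by fun_prop)]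
  refine lintegral_mono fun y => ?_
  have hn : |ψ y|.toNNReal = ‖ψ y‖₊ := by
    rw [← Real.norm_eq_abs]; exact norm_toNNReal
  have h2 : (c ‖ψ y‖₊ : ℝ≥0∞) = ENNReal.ofReal (c ‖ψ y‖₊) := (ENNReal.ofReal_coe_nnreal).symm
  have h3 := hlc y
  have h4 := Real.sq_sqrt (show 0 ≤ 2 * ((c ‖ψ y‖₊ : ℝ) - l * |ψ y|) by linarith)
  have h5 := Real.sqrt_nonneg (2 * ((c ‖ψ y‖₊ : ℝ) - l * |ψ y|))
  rw [h2, ← ENNReal.ofReal_add (by positivity) (by unfold modicaMortola; positivity),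
    ← ENNReal.ofReal_add (by positivity) (by positivity)]
  refine ENNReal.ofReal_le_ofReal ?_
  rw [modicaMortola, hn]
  -- Young's inequality; equality would be equipartition ½ψ'² = c(|ψ|) - l|ψ|.
  nlinarith [sq_nonneg (√(2 * ((c ‖ψ y‖₊ : ℝ) - l * |ψ y|)) - |deriv ψ y|)]

end LowerBound

/-! ### The lower bound for the power cost. -/

section PowerCost

variable {α a p κ : ℝ} {c : ℝ≥0 → ℝ≥0}

theorem beta_three_halves (ha : 0 < a) : beta a (3 / 2) * (2 * a + 1) = beta a (1 / 2) := by
  have h1 : Real.Gamma (a + 1 / 2) ≠ 0 := (Real.Gamma_pos_of_pos (by positivity)).ne'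
  rw [beta, beta, show (3 / 2 : ℝ) = 1 / 2 + 1 by norm_num, ← add_assoc,
    Real.Gamma_add_one (show (1 / 2 : ℝ) ≠ 0 by norm_num),
    Real.Gamma_add_one (show a + 1 / 2 ≠ 0 by positivity)]
  field_simp

theorem image_const_mul_rpow_Ioo {M s : ℝ} (hM : 0 < M) (hs : 0 < s) :
    (fun x => M * x ^ s) '' Ioo (0 : ℝ) 1 = Ioo 0 M := by
  ext y
  constructor
  · rintro ⟨x, hx, rfl⟩
    have h1 : x ^ s < 1 := Real.rpow_lt_one hx.1.le hx.2 hs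
    have h2 : 0 < x ^ s := Real.rpow_pos_of_pos hx.1 s
    exact ⟨by positivity, by simp only []; nlinarith⟩
  · rintro ⟨h1, h2⟩
    have h3 : 0 < y / M := by positivity
    refine ⟨(y / M) ^ s⁻¹, ⟨by positivity,
      Real.rpow_lt_one h3.le ((div_lt_one hM).2 h2) (by positivity)⟩, ?_⟩
    simp only []
    rw [← Real.rpow_mul h3.le, inv_mul_cancel₀ hs.ne', Real.rpow_one]
    field_simp

/-- Substituting x = M u^(1/p) factors the difference as κ x^(1-p) (1-u), which leaves a Beta
integrand. -/
theorem lintegral_sqrt_power_sub {M : ℝ} (hκ : 0 < κ) (ha : 0 < a) (hp : p = 3 / (2 * a + 1))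
    (hM : 0 < M) :
    ∫⁻ x in Ioo 0 M, ENNReal.ofReal √(2 * (κ * x ^ (1 - p) - κ * M ^ (-p) * x)) =
      ENNReal.ofReal (√(2 * κ) * M ^ (a * p) / p * beta a (3 / 2)) := by
  have hp0 : 0 < p := by rw [hp]; positivity
  have hap : a * p = (3 - p) / 2 := by rw [hp]; field_simp; ring
  rw [← image_const_mul_rpow_Ioo hM (inv_pos.2 hp0),
    lintegral_image_eq_lintegral_abs_deriv_mul (f' := fun x => M * (p⁻¹ * x ^ (p⁻¹ - 1)))
      measurableSet_Ioo]
  · have : ∀ x ∈ Ioo (0 : ℝ) 1, ENNReal.ofReal |M * (p⁻¹ * x ^ (p⁻¹ - 1))| *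
        ENNReal.ofReal √(2 * (κ * (M * x ^ p⁻¹) ^ (1 - p) - κ * M ^ (-p) * (M * x ^ p⁻¹))) =
        ENNReal.ofReal (√(2 * κ) * M ^ (a * p) / p) *
          ENNReal.ofReal (x ^ (a - 1) * (1 - x) ^ ((3 / 2 : ℝ) - 1)) := by
      intro x ⟨hx0, hx1⟩
      have h1x : 0 < 1 - x := by linarith
      have hxp : 0 < x ^ p⁻¹ := by positivity
      have e1 : κ * (M * x ^ p⁻¹) ^ (1 - p) - κ * M ^ (-p) * (M * x ^ p⁻¹) =
          κ * (M * x ^ p⁻¹) ^ (1 - p) * (1 - x) := by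
        have : (M * x ^ p⁻¹) ^ (1 - p) * x = M ^ (-p) * (M * x ^ p⁻¹) := by
          rw [Real.mul_rpow hM.le hxp.le, ← Real.rpow_mul hx0.le, mul_assoc,
            ← Real.rpow_add_one hx0.ne', ← mul_assoc, ← Real.rpow_add_one hM.ne']
          congr 2
          · ring
          · field_simp; ring
        linear_combination κ * this
      have e2 : √((M * x ^ p⁻¹) ^ (1 - p)) = M ^ ((1 - p) / 2) * x ^ ((1 - p) / (2 * p)) := by
        rw [Real.sqrt_eq_rpow, ← Real.rpow_mul (by positivity),
          Real.mul_rpow hM.le hxp.le, ← Real.rpow_mul hx0.le]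
        congr 2
        · ring
        · field_simp
      have e3 : M ^ (a * p) = M * M ^ ((1 - p) / 2) := by
        rw [hap, mul_comm, ← Real.rpow_add_one hM.ne']
        congr 1
        ring
      have e4 : x ^ (a - 1) = x ^ (p⁻¹ - 1) * x ^ ((1 - p) / (2 * p)) := by
        rw [← Real.rpow_add hx0]
        congr 1
        rw [hp]
        field_simp
        ring
      rw [← ENNReal.ofReal_mul (by positivity), ← ENNReal.ofReal_mul (by positivity), e1,
        show 2 * (κ * (M * x ^ p⁻¹) ^ (1 - p) * (1 - x)) =
          2 * κ * (M * x ^ p⁻¹) ^ (1 - p) * (1 - x) by ring,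
        Real.sqrt_mul (by positivity), Real.sqrt_mul (by positivity), e2, e3, e4, show (3 / 2 : ℝ) - 1 = 1 / 2 by norm_num, ← Real.sqrt_eq_rpow,
        abs_of_pos (by positivity)]
      congr 1
      field_simp
    rw [setLIntegral_congr_fun measurableSet_Ioo this, lintegral_const_mul' _ _ (by simp),
      lintegral_beta ha (by norm_num), ← ENNReal.ofReal_mul (by positivity)]
  · intro x hx
    exact ((Real.hasDerivAt_rpow_const (.inl hx.1.ne')).const_mul M).hasDerivWithinAt
  · intro x hx y hy hxy
    exact Real.rpow_left_injOn (inv_pos.2 hp0).ne' hx.1.le hy.1.le (mul_left_cancel₀ hM.ne' hxy)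

/-- The right-hand side is the conjugate of τ at l = κ M^(-p): the cost of rising to the level M and
falling again matches the conjugate exactly. -/
theorem two_mul_lintegral_sqrt_power_sub {M : ℝ} (hα₀ : 0 < α) (hα₁ : α < 1) (hκ : 0 < κ)
    (ha : a = α / (1 - α)) (hp : p = 3 / (2 * a + 1))
    (hκa : κ ^ a * √κ * (2 * √2 / 3) * beta a (1 / 2) = (1 - α) * α ^ a) (hM : 0 < M) :
    2 * ∫⁻ x in Ioc 0 M, ENNReal.ofReal √(2 * (κ * x ^ (1 - p) - κ * M ^ (-p) * x)) =
      ENNReal.ofReal ((1 - α) * (κ * M ^ (-p) / α) ^ (α / (α - 1))) := by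
  have h1 : 0 < 1 - α := by linarith
  have ha0 : 0 < a := by rw [ha]; positivity
  have hp0 : 0 < p := by rw [hp]; positivity
  have he : α / (α - 1) = -a := by rw [ha, ← div_neg, neg_sub]
  rw [setLIntegral_congr Ioo_ae_eq_Ioc.symm, lintegral_sqrt_power_sub hκ ha0 hp hM,
    show (2 : ℝ≥0∞) = ENNReal.ofReal 2 by simp, ← ENNReal.ofReal_mul zero_le_two]
  congr 1
  have e1 : (κ * M ^ (-p) / α) ^ (α / (α - 1)) = α ^ a * M ^ (a * p) / κ ^ a := by
    rw [he, Real.div_rpow (by positivity) hα₀.le, Real.mul_rpow hκ.le (by positivity),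
      ← Real.rpow_mul hM.le, Real.rpow_neg hα₀.le, Real.rpow_neg hκ.le,
      show -p * -a = a * p by ring]
    field_simp
  have e2 : beta a (3 / 2) / p = beta a (1 / 2) / 3 := by
    rw [← beta_three_halves ha0, hp]
    field_simp
  rw [e1, Real.sqrt_mul zero_le_two]
  calc _ = 2 * (√2 * √κ * M ^ (a * p) * (beta a (3 / 2) / p)) := by ring
    _ = (κ ^ a * √κ * (2 * √2 / 3) * beta a (1 / 2)) * M ^ (a * p) / κ ^ a := by
      rw [e2]; field_simp
    _ = _ := by rw [hκa]; ring

theorem continuousOn_power_cost (hcp : ∀ φ, 0 < φ → (c φ : ℝ) = κ * (φ : ℝ) ^ (1 - p)) :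
    ContinuousOn (fun x : ℝ => (c x.toNNReal : ℝ)) (Ioi 0) := by
  have h : ContinuousOn (fun x : ℝ => κ * x ^ (1 - p)) (Ioi 0) :=
    continuousOn_const.mul
      (continuousOn_id.rpow_const fun x hx => .inl (ne_of_gt hx))
  refine h.congr fun x hx => ?_
  have hx0 : (0 : ℝ) < x := hx
  simp only []
  rw [hcp _ (Real.toNNReal_pos.2 hx0), Real.coe_toNNReal _ hx0.le]

/-- Almost optimal multipliers: `l` approximates `κ m ^ (-p)` for a level `m` attained by `|ψ|`. -/
theorem exists_multiplier {ψ : ℝ → ℝ} (hκ : 0 < κ) (hp : 0 < p)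
    (hcp : ∀ φ, 0 < φ → (c φ : ℝ) = κ * (φ : ℝ) ^ (1 - p)) {y : ℝ} (hy : ψ y ≠ 0) {δ : ℝ}
    (hδ : 0 < δ) :
    ∃ m > 0, ∃ y₀, m ≤ |ψ y₀| ∧ ∃ l, 0 ≤ l ∧ l ≤ κ * m ^ (-p) ∧ κ * m ^ (-p) ≤ l + δ ∧
      ∀ x, l * |ψ x| ≤ c ‖ψ x‖₊ := by
  by_cases hb : BddAbove (range fun x => |ψ x|)
  -- Bounded case: `l` belongs to the supremum `M`, and `m` is an attained level bound just below
  -- `M`.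
  · have hle : ∀ x, |ψ x| ≤ ⨆ x, |ψ x| := le_ciSup hb
    set M := ⨆ x, |ψ x| with hM
    have hM0 : 0 < M := (abs_pos.2 hy).trans_le (hle y)
    have hcont : ContinuousAt (fun m : ℝ => κ * m ^ (-p)) M :=
      continuousAt_const.mul (Real.continuousAt_rpow_const _ _ (.inl hM0.ne'))
    have hev : ∀ᶠ m in nhdsWithin M (Iio M), κ * m ^ (-p) < κ * M ^ (-p) + δ ∧ 0 < m ∧ m < M := by
      have h1 : ∀ᶠ m in nhds M, κ * m ^ (-p) < κ * M ^ (-p) + δ :=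
        hcont.eventually_lt continuousAt_const (by linarith)
      filter_upwards [nhdsWithin_le_nhds h1, nhdsWithin_le_nhds (lt_mem_nhds hM0),
        self_mem_nhdsWithin] with m h1 h2 h3
      exact ⟨h1, h2, h3⟩
    obtain ⟨m, hm1, hm0, hmM⟩ := hev.exists
    obtain ⟨y₀, hy₀⟩ := exists_lt_of_lt_ciSup hmM
    refine ⟨m, hm0, y₀, hy₀.le, κ * M ^ (-p), by positivity, ?_, hm1.le, fun x => ?_⟩
    · exact mul_le_mul_of_nonneg_left
        (Real.rpow_le_rpow_of_nonpos hm0 hmM.le (by linarith)) hκ.le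
    · rcases eq_or_ne (ψ x) 0 with h0 | h0
      · simp [h0]
      · have hx0 : 0 < |ψ x| := abs_pos.2 h0
        rw [hcp _ (nnnorm_pos.2 h0), coe_nnnorm, Real.norm_eq_abs, mul_assoc,
          show 1 - p = -p + 1 by ring, Real.rpow_add_one hx0.ne']
        gcongr κ * (?_ * _)
        exact Real.rpow_le_rpow_of_nonpos hx0 (hle x) (by linarith)
  -- Unbounded case: l = 0 works, since κ m^(-p) tends to 0 along arbitrarily high levels.
  · have ht : Filter.Tendsto (fun m : ℝ => κ * m ^ (-p)) Filter.atTop (nhds (κ * 0)) :=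
      (tendsto_rpow_neg_atTop hp).const_mul κ
    rw [mul_zero] at ht
    obtain ⟨m, hm1, hm0⟩ := ((ht.eventually (gt_mem_nhds hδ)).and
      (Filter.eventually_gt_atTop 0)).exists
    rw [not_bddAbove_iff] at hb
    obtain ⟨_, ⟨y₀, rfl⟩, hy₀⟩ := hb m
    exact ⟨m, hm0, y₀, hy₀.le, 0, le_rfl, by positivity, by simpa using hm1.le, by simp⟩

/-- The lower bound `w ^ α ≤ F^c[ψ]` for phase fields `ψ` of mass `w`. -/
theorem rpow_le_phaseFieldEnergy {ψ : ℝ → ℝ} {w : ℝ} (hα₀ : 0 < α) (hα₁ : α < 1) (hκ : 0 < κ)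
    (ha : a = α / (1 - α)) (hp : p = 3 / (2 * a + 1))
    (hκa : κ ^ a * √κ * (2 * √2 / 3) * beta a (1 / 2) = (1 - α) * α ^ a)
    (hcp : ∀ φ, 0 < φ → (c φ : ℝ) = κ * (φ : ℝ) ^ (1 - p)) (hw : 0 ≤ w)
    (hψ : ψ ∈ phaseFieldsOfMass w) :
    ENNReal.ofReal (w ^ α) ≤ phaseFieldEnergy c ψ := by
  obtain ⟨hAC, hi, hint⟩ := hψ
  have h1 : 0 < 1 - α := by linarith
  have ha0 : 0 < a := by rw [ha]; positivity
  have hp0 : 0 < p := by rw [hp]; positivity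
  rcases hw.eq_or_lt with rfl | hw0
  · simp [Real.zero_rpow hα₀.ne']
  obtain ⟨y, hy⟩ : ∃ y, ψ y ≠ 0 := by
    by_contra! h
    simp [h] at hint
    exact hw0.ne hint
  set W := ∫ y, |ψ y| with hW
  have hwW : w ≤ W := by
    rw [← hint]
    exact integral_mono hi hi.abs fun y => le_abs_self _
  have hW0 : 0 < W := hw0.trans_le hwW
  refine ENNReal.le_of_forall_pos_le_add fun δ hδ _ => ?_
  have hδ' : (0 : ℝ) < δ := hδ
  -- The tolerance δ/W becomes `δ` once the multiplier is multiplied by the mass `W`.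
  obtain ⟨m, hm, y₀, hmy, l, hl, hlm, hml, hlc⟩ :=
    exists_multiplier (ψ := ψ) hκ hp0 hcp hy (div_pos hδ' hW0)
  have key := le_phaseFieldEnergy (continuousOn_power_cost hcp) hAC hi hl hlc hmy
  have hmono : ENNReal.ofReal ((1 - α) * (κ * m ^ (-p) / α) ^ (α / (α - 1))) ≤
      2 * ∫⁻ x in Ioc 0 m, ENNReal.ofReal (modicaMortola c l x) := by
    rw [← two_mul_lintegral_sqrt_power_sub hα₀ hα₁ hκ ha hp hκa hm]
    refine mul_le_mul_right (setLIntegral_mono' measurableSet_Ioc fun x hx => ?_) _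
    refine ENNReal.ofReal_le_ofReal (Real.sqrt_le_sqrt ?_)
    rw [hcp _ (Real.toNNReal_pos.2 hx.1), Real.coe_toNNReal _ hx.1.le]
    have := mul_le_mul_of_nonneg_right hlm hx.1.le
    linarith
  refine le_trans ?_ (add_le_add (le_trans (add_le_add le_rfl hmono) key) le_rfl)
  have hδe : (δ : ℝ≥0∞) = ENNReal.ofReal δ := (ENNReal.ofReal_coe_nnreal).symm
  rw [hδe, ← ENNReal.ofReal_add (by positivity) (by positivity),
    ← ENNReal.ofReal_add (by positivity) (by positivity)]
  refine ENNReal.ofReal_le_ofReal ?_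
  have t1 := rpow_le_tangent hα₀ hα₁ (show 0 < κ * m ^ (-p) by positivity) hW0.le
  have t2 : w ^ α ≤ W ^ α := Real.rpow_le_rpow hw hwW hα₀.le
  have t3 := mul_le_mul_of_nonneg_right hml hW0.le
  rw [add_mul, div_mul_cancel₀ _ hW0.ne'] at t3
  linarith

end PowerCost

/-! ### Construction of optimal phase fields. -/

/-- Since |ψ'| ≤ ½ + ½|ψ'|², finite gradient energy makes ψ' locally integrable, and ψ is then a
primitive of it. -/
theorem locallyAbsolutelyContinuous_of_differentiable_off_countable {ψ : ℝ → ℝ} {s : Set ℝ}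
    (hc : Continuous ψ) (hs : s.Countable) (hd : ∀ x ∉ s, DifferentiableAt ℝ ψ x)
    (hfin : ∫⁻ x, ENNReal.ofReal (1 / 2 * |deriv ψ x| ^ 2) ≠ ⊤) :
    LocallyAbsolutelyContinuous ψ := by
  have hi : ∀ a b, IntervalIntegrable (deriv ψ) volume a b := by
    intro a b
    have h1 : Integrable fun x => 1 / 2 * |deriv ψ x| ^ 2 := by
      refine ⟨(((measurable_deriv ψ).abs.pow_const 2).const_mul _).aestronglyMeasurable, ?_⟩
      rw [hasFiniteIntegral_iff_ofReal (.of_forall fun x => by positivity)]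
      exact lt_top_iff_ne_top.2 hfin
    have h2 : IntervalIntegrable (fun x => 1 / 2 + 1 / 2 * |deriv ψ x| ^ 2) volume a b :=
      intervalIntegrable_const.add h1.intervalIntegrable
    refine h2.mono_fun (measurable_deriv ψ).aestronglyMeasurable (.of_forall fun x => ?_)
    simp only []
    rw [Real.norm_eq_abs, Real.norm_of_nonneg (by positivity)]
    nlinarith [sq_nonneg (|deriv ψ x| - 1)]
  intro a b
  have hrep : ψ = fun x => ψ a + ∫ t in a..x, deriv ψ t := by
    funext x
    rw [integral_eq_of_hasDerivAt_off_countable ψ (deriv ψ) hs hc.continuousOn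
      (fun y hy => (hd y hy.2).hasDerivAt) (hi a x)]
    ring
  rw [hrep]
  exact ((LipschitzWith.const (ψ a)).lipschitzOnWith.absolutelyContinuousOnInterval).fun_add
    ((hi a b).absolutelyContinuousOnInterval_intervalIntegral left_mem_uIcc)

section Reparametrization

variable {d e : ℝ}

/-- The density `d (1 - v²)^e` on `(-1,1)`, extended by `1`. -/
noncomputable def speed (d e v : ℝ) : ℝ :=
  (Ioo (-1 : ℝ) 1).indicator (fun v => d * (1 - v ^ 2) ^ e) v +
    (Ioo (-1 : ℝ) 1)ᶜ.indicator (fun _ => 1) v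

theorem speed_of_mem {v : ℝ} (hv : v ∈ Ioo (-1 : ℝ) 1) : speed d e v = d * (1 - v ^ 2) ^ e := by
  simp only [speed, indicator_of_mem hv, indicator_of_notMem (notMem_compl_iff.2 hv), add_zero]

theorem speed_of_notMem {v : ℝ} (hv : v ∉ Ioo (-1 : ℝ) 1) : speed d e v = 1 := by
  simp only [speed, indicator_of_notMem hv, indicator_of_mem (mem_compl hv), zero_add]

theorem one_sub_sq_pos {v : ℝ} (hv : v ∈ Ioo (-1 : ℝ) 1) : 0 < 1 - v ^ 2 := by
  nlinarith [hv.1, hv.2]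

theorem speed_pos (hd : 0 < d) (v : ℝ) : 0 < speed d e v := by
  by_cases hv : v ∈ Ioo (-1 : ℝ) 1
  · have := one_sub_sq_pos hv
    rw [speed_of_mem hv]
    positivity
  · rw [speed_of_notMem hv]
    exact one_pos

theorem measurable_speed : Measurable (speed d e) := by
  unfold speed
  exact (Measurable.indicator (by fun_prop) measurableSet_Ioo).add
    (Measurable.indicator (by fun_prop) measurableSet_Ioo.compl)

theorem integrableOn_one_sub_sq_rpow {a : ℝ} (ha : 0 < a) :
    IntegrableOn (fun v : ℝ => (1 - v ^ 2) ^ (a - 1)) (Ioo (-1) 1) := by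
  have hm : Measurable fun v : ℝ => (1 - v ^ 2) ^ (a - 1) := by fun_prop
  refine ⟨hm.aestronglyMeasurable, ?_⟩
  rw [hasFiniteIntegral_iff_ofReal, lintegral_one_sub_sq_rpow ha]
  · exact ENNReal.ofReal_lt_top
  · refine (ae_restrict_iff' measurableSet_Ioo).2 (.of_forall fun v hv => ?_)
    have := one_sub_sq_pos hv
    positivity

theorem intervalIntegrable_speed (he : -1 < e) (u v : ℝ) :
    IntervalIntegrable (speed d e) volume u v := by
  have h1 : Integrable ((Ioo (-1 : ℝ) 1).indicator fun v => d * (1 - v ^ 2) ^ e) := by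
    rw [integrable_indicator_iff measurableSet_Ioo]
    have := integrableOn_one_sub_sq_rpow (a := e + 1) (by linarith)
    rw [add_sub_cancel_right] at this
    exact this.const_mul d
  have h2 : IntervalIntegrable ((Ioo (-1 : ℝ) 1)ᶜ.indicator fun _ => (1 : ℝ)) volume u v := by
    refine (intervalIntegrable_const (c := (1 : ℝ))).mono_fun
      ((measurable_const.indicator measurableSet_Ioo.compl).aestronglyMeasurable)
      (.of_forall fun x => ?_)
    exact norm_indicator_le_norm_self _ _
  exact h1.intervalIntegrable.add h2

theorem strictMono_integral_speed (hd : 0 < d) (he : -1 < e) :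
    StrictMono fun v => ∫ x in (0 : ℝ)..v, speed d e x := by
  intro u v huv
  have h := intervalIntegral.integral_add_adjacent_intervals
    (intervalIntegrable_speed (d := d) he 0 u) (intervalIntegrable_speed he u v)
  have hp := intervalIntegral.intervalIntegral_pos_of_pos (intervalIntegrable_speed he u v)
    (speed_pos hd) huv
  simp only []
  linarith

theorem integral_speed_eq_sub {u v : ℝ} (huv : u ≤ v) (h : ∀ x ∈ Icc u v, x ∉ Ioo (-1 : ℝ) 1) :
    ∫ x in u..v, speed d e x = v - u := by
  rw [intervalIntegral.integral_congr (g := fun _ => (1 : ℝ))]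
  · simp
  · intro x hx
    rw [uIcc_of_le huv] at hx
    exact speed_of_notMem (h x hx)

theorem continuous_integral_speed (he : -1 < e) :
    Continuous fun v => ∫ x in (0 : ℝ)..v, speed d e x :=
  intervalIntegral.continuous_primitive (fun u v => intervalIntegrable_speed he u v) 0

/-- The density 1 outside (-1, 1) sends the primitive to ±∞ at ±∞. -/
theorem surjective_integral_speed (he : -1 < e) :
    Function.Surjective fun v => ∫ x in (0 : ℝ)..v, speed d e x := by
  have hadd : ∀ u v, ∫ x in (0 : ℝ)..v, speed d e x =
      (∫ x in (0 : ℝ)..u, speed d e x) + ∫ x in u..v, speed d e x := fun u v =>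
    (intervalIntegral.integral_add_adjacent_intervals
      (intervalIntegrable_speed he 0 u) (intervalIntegrable_speed he u v)).symm
  refine (continuous_integral_speed he).surjective ?_ ?_
  · refine Filter.Tendsto.congr' (f₁ := fun v => (∫ x in (0 : ℝ)..1, speed d e x) + (v - 1)) ?_ ?_
    · filter_upwards [Filter.eventually_ge_atTop 1] with v hv
      rw [hadd 1 v, integral_speed_eq_sub hv fun x hx hx' => by linarith [hx.1, hx'.2]]
    · exact Filter.tendsto_atTop_add_const_left _ _
        (Filter.tendsto_atTop_add_const_right _ _ Filter.tendsto_id)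
  · refine Filter.Tendsto.congr' (f₁ := fun v => (∫ x in (0 : ℝ)..(-1), speed d e x) + (v - -1))
      ?_ ?_
    · filter_upwards [Filter.eventually_le_atBot (-1)] with v hv
      rw [hadd (-1) v, intervalIntegral.integral_symm v (-1),
        integral_speed_eq_sub hv fun x hx hx' => by linarith [hx.2, hx'.1]]
      ring
    · exact Filter.tendsto_atBot_add_const_left _ _
        (Filter.tendsto_atBot_add_const_right _ _ Filter.tendsto_id)

theorem hasDerivAt_integral_speed (he : -1 < e) {v : ℝ} (hv : v ∈ Ioo (-1 : ℝ) 1) :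
    HasDerivAt (fun v => ∫ x in (0 : ℝ)..v, speed d e x) (d * (1 - v ^ 2) ^ e) v := by
  rw [← speed_of_mem (d := d) (e := e) hv]
  refine intervalIntegral.integral_hasDerivAt_right (intervalIntegrable_speed he 0 v)
    measurable_speed.stronglyMeasurable.stronglyMeasurableAtFilter ?_
  have h1 : ContinuousAt (fun v : ℝ => d * (1 - v ^ 2) ^ e) v :=
    continuousAt_const.mul
      (ContinuousAt.rpow_const (by fun_prop) (.inl (one_sub_sq_pos hv).ne'))
  refine h1.congr ?_
  filter_upwards [isOpen_Ioo.mem_nhds hv] with x hx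
  exact (speed_of_mem hx).symm

/-- A homeomorphism `V` of the line whose inverse has derivative `d (1 - v²)^e` on `(-1,1)`. -/
theorem exists_reparametrization (hd : 0 < d) (he : -1 < e) :
    ∃ V : ℝ → ℝ, Continuous V ∧ Function.Injective V ∧
      (∀ y, V y ∈ Ioo (-1 : ℝ) 1 → HasDerivAt V (d * (1 - V y ^ 2) ^ e)⁻¹ y) ∧
      ∀ G : ℝ → ℝ≥0∞, ∫⁻ y in V ⁻¹' Ioo (-1) 1, G (V y) =
        ∫⁻ v in Ioo (-1 : ℝ) 1, ENNReal.ofReal (d * (1 - v ^ 2) ^ e) * G v := by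
  set Y := StrictMono.orderIsoOfSurjective _ (strictMono_integral_speed hd he)
    (surjective_integral_speed (d := d) he) with hY
  have hYd : ∀ v ∈ Ioo (-1 : ℝ) 1, HasDerivAt Y (d * (1 - v ^ 2) ^ e) v := fun v hv =>
    hasDerivAt_integral_speed he hv
  have hpos : ∀ v ∈ Ioo (-1 : ℝ) 1, 0 < d * (1 - v ^ 2) ^ e := fun v hv => by
    have := one_sub_sq_pos hv
    positivity
  refine ⟨Y.symm, Y.symm.continuous, Y.symm.injective, fun y hy => ?_, fun G => ?_⟩
  · exact HasDerivAt.of_local_left_inverse Y.symm.continuous.continuousAt (hYd _ hy) (hpos _ hy).ne'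
      (.of_forall fun x => Y.apply_symm_apply x)
  · have him : Y.symm ⁻¹' Ioo (-1) 1 = Y '' Ioo (-1) 1 :=
      (Y.toEquiv.image_eq_preimage_symm _).symm
    rw [him, lintegral_image_eq_lintegral_abs_deriv_mul measurableSet_Ioo
      (fun v hv => (hYd v hv).hasDerivWithinAt) Y.injective.injOn]
    refine setLIntegral_congr_fun measurableSet_Ioo fun v hv => ?_
    rw [abs_of_pos (hpos v hv), Y.symm_apply_apply]

end Reparametrization

section Profile

variable {a κ M d : ℝ} {c : ℝ≥0 → ℝ≥0}

theorem lintegral_one_sub_sq_rpow_self (ha : 0 < a) :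
    ∫⁻ v in Ioo (-1 : ℝ) 1, ENNReal.ofReal ((1 - v ^ 2) ^ a) =
      ENNReal.ofReal (2 * a / (2 * a + 1) * beta (1 / 2) a) := by
  have h := lintegral_one_sub_sq_rpow (a := a + 1) (by positivity)
  rw [add_sub_cancel_right] at h
  rw [h]
  congr 1
  have := beta_succ ha
  field_simp
  linarith

/-- Adding (1-v²)^a to the integrand gives 2(1-v²)^(a-1), and both of these integrals are known. -/
theorem lintegral_one_sub_sq_rpow_mul_one_add_sq (ha : 0 < a) :
    ∫⁻ v in Ioo (-1 : ℝ) 1, ENNReal.ofReal ((1 - v ^ 2) ^ (a - 1) * (1 + v ^ 2)) =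
      ENNReal.ofReal ((2 * a + 2) / (2 * a + 1) * beta (1 / 2) a) := by
  have hb := beta_pos one_half_pos ha
  have hsum : ∫⁻ v in Ioo (-1 : ℝ) 1, (ENNReal.ofReal ((1 - v ^ 2) ^ (a - 1) * (1 + v ^ 2)) +
      ENNReal.ofReal ((1 - v ^ 2) ^ a)) = ENNReal.ofReal (2 * beta (1 / 2) a) := by
    have : ∀ v ∈ Ioo (-1 : ℝ) 1, ENNReal.ofReal ((1 - v ^ 2) ^ (a - 1) * (1 + v ^ 2)) +
        ENNReal.ofReal ((1 - v ^ 2) ^ a) =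
        ENNReal.ofReal 2 * ENNReal.ofReal ((1 - v ^ 2) ^ (a - 1)) := by
      intro v hv
      have h0 := one_sub_sq_pos hv
      rw [← ENNReal.ofReal_add (by positivity) (by positivity),
        ← ENNReal.ofReal_mul (by norm_num)]
      congr 1
      have : (1 - v ^ 2) ^ a = (1 - v ^ 2) ^ (a - 1) * (1 - v ^ 2) := by
        rw [← Real.rpow_add_one h0.ne', sub_add_cancel]
      rw [this]
      ring
    rw [setLIntegral_congr_fun measurableSet_Ioo this, lintegral_const_mul' _ _ (by simp),
      lintegral_one_sub_sq_rpow ha, ← ENNReal.ofReal_mul (by norm_num)]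
  rw [lintegral_add_right _ (by fun_prop), lintegral_one_sub_sq_rpow_self ha] at hsum
  refine (ENNReal.add_left_inj ENNReal.ofReal_ne_top).1 (hsum.trans ?_)
  rw [← ENNReal.ofReal_add (by positivity) (by positivity)]
  congr 1
  field_simp
  ring

/-- The profile `v ↦ M (1 - v²)₊^r` of an optimal phase field. -/
noncomputable def profile (M r v : ℝ) : ℝ := M * max (1 - v ^ 2) 0 ^ r

theorem profile_of_mem {r v : ℝ} (hv : v ∈ Ioo (-1 : ℝ) 1) :
    profile M r v = M * (1 - v ^ 2) ^ r := by
  rw [profile, max_eq_left (one_sub_sq_pos hv).le]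

theorem profile_of_notMem {r v : ℝ} (hr : 0 < r) (hv : v ∉ Ioo (-1 : ℝ) 1) :
    profile M r v = 0 := by
  have : 1 - v ^ 2 ≤ 0 := by
    by_contra! h
    exact hv (abs_lt.1 ((sq_lt_one_iff_abs_lt_one v).1 (by linarith)))
  rw [profile, max_eq_right this, Real.zero_rpow hr.ne', mul_zero]

theorem continuous_profile {r : ℝ} (hr : 0 < r) : Continuous (profile M r) := by
  unfold profile
  exact continuous_const.mul (Continuous.rpow_const (by fun_prop) fun _ => .inr hr.le)

theorem hasDerivAt_profile {r v : ℝ} (hv : v ∈ Ioo (-1 : ℝ) 1) :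
    HasDerivAt (profile M r) (M * (-(2 * v) * r * (1 - v ^ 2) ^ (r - 1))) v := by
  have h1 : HasDerivAt (fun v : ℝ => 1 - v ^ 2) (-(2 * v)) v := by
    simpa using (hasDerivAt_pow 2 v).const_sub 1
  have h2 := (h1.rpow_const (p := r) (.inl (one_sub_sq_pos hv).ne')).const_mul M
  refine h2.congr_of_eventuallyEq ?_
  filter_upwards [isOpen_Ioo.mem_nhds hv] with x hx
  exact profile_of_mem hx

/-- An explicit phase field satisfying the equipartition identity of the energy minus its
Lagrange multiplier term. -/
theorem exists_phaseField (ha : 0 < a) (hκ : 0 < κ) (hM : 0 < M) (hd : 0 < d) (hc₀ : c 0 = 0)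
    (hcp : ∀ φ, 0 < φ → (c φ : ℝ) = κ * (φ : ℝ) ^ (1 - 3 / (2 * a + 1)))
    (hMd : (2 * ((2 * a + 1) / 3) * M / d) ^ 2 = 2 * κ * M ^ (1 - 3 / (2 * a + 1))) :
    ∃ ψ ∈ phaseFieldsOfMass (d * M * (2 * a / (2 * a + 1) * beta (1 / 2) a)),
      phaseFieldEnergy c ψ = ENNReal.ofReal (d * κ * M ^ (1 - 3 / (2 * a + 1)) *
        ((2 * a + 2) / (2 * a + 1) * beta (1 / 2) a)) := by
  have hb := beta_pos one_half_pos ha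
  -- These exponents make c(ψ) and ψ'²/v² both multiples of (1-v²)^(2e), as rq = 2e and r - 1 - e =
  -- e. With the weight (1-v²)^e the mass has exponent e + r = a and the energy 3e = a - 1.
  set r := (2 * a + 1) / 3 with hr
  set e := (a - 1) / 3 with he
  set q := 1 - 3 / (2 * a + 1) with hq
  have hr0 : 0 < r := by positivity
  have hrq : r * q = 2 * e := by rw [hr, hq, he]; field_simp; ring
  obtain ⟨V, hVc, hVi, hVd, hVint⟩ := exists_reparametrization (d := d) (e := e) hd (by
    rw [he]; linarith)
  set ψ : ℝ → ℝ := fun y => profile M r (V y) with hψ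
  have hψc : Continuous ψ := (continuous_profile hr0).comp hVc
  set s : Set ℝ := V ⁻¹' {-1, 1} with hs
  have hsf : s.Finite := (Set.toFinite _).preimage hVi.injOn
  have hin : ∀ y ∈ V ⁻¹' Ioo (-1) 1, HasDerivAt ψ (M * (-(2 * V y) * r *
      (1 - V y ^ 2) ^ (r - 1)) * (d * (1 - V y ^ 2) ^ e)⁻¹) y := fun y hy =>
    (hasDerivAt_profile hy).comp y (hVd y hy)
  have hout : ∀ y ∉ V ⁻¹' Ioo (-1) 1, ψ y = 0 := fun y hy => profile_of_notMem hr0 hy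
  have hout' : ∀ y ∉ V ⁻¹' Ioo (-1) 1, y ∉ s → HasDerivAt ψ 0 y := by
    intro y hy hys
    have hy' : V y ∈ (Icc (-1 : ℝ) 1)ᶜ := by
      intro h
      simp only [hs, mem_preimage, mem_insert_iff, mem_singleton_iff, not_or] at hys
      exact hy ⟨lt_of_le_of_ne h.1 (Ne.symm hys.1), lt_of_le_of_ne h.2 hys.2⟩
    refine (hasDerivAt_const y (0 : ℝ)).congr_of_eventuallyEq ?_
    filter_upwards [hVc.continuousAt.preimage_mem_nhds (isClosed_Icc.isOpen_compl.mem_nhds hy')]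
      with x hx
    exact hout x fun hx' => hx (Ioo_subset_Icc_self hx')
  have hdiff : ∀ y ∉ s, DifferentiableAt ℝ ψ y := by
    intro y hy
    by_cases h : y ∈ V ⁻¹' Ioo (-1) 1
    · exact (hin y h).differentiableAt
    · exact (hout' y h hy).differentiableAt
  have hVm : MeasurableSet (V ⁻¹' Ioo (-1) 1) := hVc.measurable measurableSet_Ioo
  have hE : phaseFieldEnergy c ψ = ENNReal.ofReal (d * κ * M ^ q *
      ((2 * a + 2) / (2 * a + 1) * beta (1 / 2) a)) := by
    rw [phaseFieldEnergy, ← lintegral_add_compl _ hVm]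
    have hz : ∫⁻ y in (V ⁻¹' Ioo (-1) 1)ᶜ,
        (ENNReal.ofReal (1 / 2 * |deriv ψ y| ^ 2) + (c ‖ψ y‖₊ : ℝ≥0∞)) = 0 := by
      rw [setLIntegral_congr_fun_ae (g := 0) hVm.compl]
      · simp
      · filter_upwards [hsf.measure_zero volume |> measure_eq_zero_iff_ae_notMem.1] with y hy hyV
        rw [(hout' y hyV hy).deriv, hout y hyV]
        simp [hc₀]
    rw [hz, add_zero]
    -- By `hMd` the gradient term is v² times the potential term, whence the factor 1 + v².
    have hG : ∀ y ∈ V ⁻¹' Ioo (-1) 1,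
        ENNReal.ofReal (1 / 2 * |deriv ψ y| ^ 2) + (c ‖ψ y‖₊ : ℝ≥0∞) =
        (fun v => ENNReal.ofReal (κ * M ^ q * (1 - v ^ 2) ^ (2 * e) * (1 + v ^ 2))) (V y) := by
      intro y hy
      have h0 := one_sub_sq_pos hy
      have hψy : ψ y = M * (1 - V y ^ 2) ^ r := profile_of_mem hy
      have hψ0 : 0 < ψ y := by rw [hψy]; positivity
      rw [(hin y hy).deriv, ← ENNReal.ofReal_coe_nnreal, hcp _ (nnnorm_pos.2 hψ0.ne'), coe_nnnorm,
        Real.norm_of_nonneg hψ0.le, hψy, ← ENNReal.ofReal_add (by positivity) (by positivity)]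
      simp only []
      congr 1
      have e1 : (1 - V y ^ 2) ^ (r - 1) * ((1 - V y ^ 2) ^ e)⁻¹ = (1 - V y ^ 2) ^ e := by
        rw [← Real.rpow_neg h0.le, ← Real.rpow_add h0]
        congr 1
        rw [hr, he]
        ring
      have e2 : (1 - V y ^ 2) ^ (2 * e) = ((1 - V y ^ 2) ^ e) ^ 2 := by
        rw [mul_comm, Real.rpow_mul h0.le, Real.rpow_two]
      have e3 : M * (-(2 * V y) * r * (1 - V y ^ 2) ^ (r - 1)) * (d * (1 - V y ^ 2) ^ e)⁻¹ =
          -((2 * r * M / d) * V y * (1 - V y ^ 2) ^ e) := by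
        have : M * (-(2 * V y) * r * (1 - V y ^ 2) ^ (r - 1)) * (d * (1 - V y ^ 2) ^ e)⁻¹ =
            -((2 * r * M / d) * V y * ((1 - V y ^ 2) ^ (r - 1) * ((1 - V y ^ 2) ^ e)⁻¹)) := by
          rw [mul_inv]
          ring
        rw [this, e1]
      rw [e3, sq_abs, neg_sq, mul_pow, mul_pow, hMd, Real.mul_rpow hM.le (by positivity),
        ← Real.rpow_mul h0.le, hrq, e2]
      ring
    rw [setLIntegral_congr_fun hVm hG, hVint fun v =>
      ENNReal.ofReal (κ * M ^ q * (1 - v ^ 2) ^ (2 * e) * (1 + v ^ 2))]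
    have hfin : ∀ v ∈ Ioo (-1 : ℝ) 1, ENNReal.ofReal (d * (1 - v ^ 2) ^ e) *
        ENNReal.ofReal (κ * M ^ q * (1 - v ^ 2) ^ (2 * e) * (1 + v ^ 2)) =
        ENNReal.ofReal (d * κ * M ^ q) * ENNReal.ofReal ((1 - v ^ 2) ^ (a - 1) * (1 + v ^ 2)) := by
      intro v hv
      have h0 := one_sub_sq_pos hv
      rw [← ENNReal.ofReal_mul (by positivity), ← ENNReal.ofReal_mul (by positivity),
        show a - 1 = e + 2 * e by rw [he]; ring, Real.rpow_add h0]
      congr 1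
      ring
    rw [setLIntegral_congr_fun measurableSet_Ioo hfin, lintegral_const_mul' _ _ (by simp),
      lintegral_one_sub_sq_rpow_mul_one_add_sq ha, ← ENNReal.ofReal_mul (by positivity)]
  have hψ0 : ∀ y, 0 ≤ ψ y := fun y => mul_nonneg hM.le (Real.rpow_nonneg (le_max_right _ _) _)
  have hmass : ∫⁻ y, ENNReal.ofReal (ψ y) =
      ENNReal.ofReal (d * M * (2 * a / (2 * a + 1) * beta (1 / 2) a)) := by
    rw [← lintegral_add_compl _ hVm, setLIntegral_congr_fun (g := 0) hVm.compl
      (fun y hy => by simp [hout y hy])]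
    simp only [Pi.zero_apply, lintegral_zero, add_zero]
    rw [hVint fun v => ENNReal.ofReal (profile M r v)]
    have hfin : ∀ v ∈ Ioo (-1 : ℝ) 1, ENNReal.ofReal (d * (1 - v ^ 2) ^ e) *
        ENNReal.ofReal (profile M r v) =
        ENNReal.ofReal (d * M) * ENNReal.ofReal ((1 - v ^ 2) ^ a) := by
      intro v hv
      have h0 := one_sub_sq_pos hv
      rw [profile_of_mem hv, ← ENNReal.ofReal_mul (by positivity),
        ← ENNReal.ofReal_mul (by positivity), show a = e + r by rw [he, hr]; ring,
        Real.rpow_add h0]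
      congr 1
      ring
    rw [setLIntegral_congr_fun measurableSet_Ioo hfin, lintegral_const_mul' _ _ (by simp),
      lintegral_one_sub_sq_rpow_self ha, ← ENNReal.ofReal_mul (by positivity)]
  refine ⟨ψ, ⟨?_, ?_, ?_⟩, hE⟩
  · refine locallyAbsolutelyContinuous_of_differentiable_off_countable hψc hsf.countable hdiff ?_
    refine ne_top_of_le_ne_top (hE ▸ ENNReal.ofReal_ne_top : phaseFieldEnergy c ψ ≠ ⊤) ?_
    exact lintegral_mono fun y => le_self_add
  · refine ⟨hψc.aestronglyMeasurable, ?_⟩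
    rw [hasFiniteIntegral_iff_ofReal (.of_forall hψ0), hmass]
    exact ENNReal.ofReal_lt_top
  · rw [integral_eq_lintegral_of_nonneg_ae (.of_forall hψ0) hψc.aestronglyMeasurable, hmass,
      ENNReal.toReal_ofReal (by positivity)]

/-- The infimum `w ^ α` of the energy is attained. -/
theorem exists_optimal_phaseField {α w : ℝ} (hα₀ : 0 < α) (hα₁ : α < 1) (hκ : 0 < κ)
    (ha : a = α / (1 - α))
    (hκa : κ ^ a * √κ * (2 * √2 / 3) * beta a (1 / 2) = (1 - α) * α ^ a) (hc₀ : c 0 = 0)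
    (hcp : ∀ φ, 0 < φ → (c φ : ℝ) = κ * (φ : ℝ) ^ (1 - 3 / (2 * a + 1))) (hw : 0 < w) :
    ∃ ψ ∈ phaseFieldsOfMass w, phaseFieldEnergy c ψ = ENNReal.ofReal (w ^ α) := by
  have h1 : 0 < 1 - α := by linarith
  have ha0 : 0 < a := by rw [ha]; positivity
  have hα : α = a / (a + 1) := by rw [ha]; field_simp; ring
  -- The multiplier is τ'(w). The height `M` solves c(M) = lM, and `d` is fixed by equipartition;
  -- that the mass is then `w` rests on `hκa`.
  set l := α * w ^ (α - 1) with hl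
  have hl0 : 0 < l := by positivity
  set r := (2 * a + 1) / 3 with hr
  have hr0 : 0 < r := by positivity
  set M := (κ / l) ^ r with hM
  have hM0 : 0 < M := by positivity
  set q := 1 - 3 / (2 * a + 1) with hq
  set d := 2 * r * (M / √(2 * κ * M ^ q)) with hd
  have hd0 : 0 < d := by positivity
  have hMd : (2 * r * M / d) ^ 2 = 2 * κ * M ^ q := by
    have : 2 * r * M / d = √(2 * κ * M ^ q) := by rw [hd]; field_simp
    rw [this, Real.sq_sqrt (by positivity)]
  obtain ⟨ψ, hψ, hE⟩ := exists_phaseField ha0 hκ hM0 hd0 hc₀ hcp hMd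
  have hMl : κ * M ^ q = l * M := by
    have : M ^ q = M * (l / κ) := by
      rw [hq, Real.rpow_sub hM0, Real.rpow_one, hM, ← Real.rpow_mul (by positivity), hr,
        div_mul_div_comm, mul_comm (2 * a + 1) 3, div_self (by positivity), Real.rpow_one]
      field_simp
    rw [this]
    field_simp
  have hmass : d * M * (2 * a / (2 * a + 1) * beta (1 / 2) a) = w := by
    have hbc : beta (1 / 2) a = beta a (1 / 2) := by
      rw [beta, beta, mul_comm, add_comm]
    have f1 : M * √M = κ ^ a * √κ / (l ^ a * √l) := by
      have : M * √M = (κ / l) ^ (a + 1 / 2) := by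
        rw [Real.sqrt_eq_rpow, ← Real.rpow_one_add' hM0.le (by norm_num), hM,
          ← Real.rpow_mul (by positivity), hr]
        congr 1
        ring
      rw [this, Real.rpow_add (by positivity), ← Real.sqrt_eq_rpow, Real.sqrt_div hκ.le,
        Real.div_rpow hκ.le hl0.le]
      field_simp
    have f2 : l ^ a * l * w = α ^ a * α := by
      rw [← Real.rpow_add_one hl0.ne', ← Real.rpow_add_one hα₀.ne', hl,
        Real.mul_rpow hα₀.le (by positivity), ← Real.rpow_mul hw.le, mul_assoc,
        ← Real.rpow_add_one hw.ne', show (α - 1) * (a + 1) + 1 = 0 by rw [ha]; field_simp; ring,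
        Real.rpow_zero, mul_one]
    have f3 : M * M / √(2 * κ * M ^ q) = κ ^ a * √κ / (√2 * (l ^ a * l)) := by
      have hlM : √(2 * κ * M ^ q) = √2 * √l * √M := by
        rw [mul_assoc, hMl, Real.sqrt_mul zero_le_two, Real.sqrt_mul hl0.le, mul_assoc]
      have h2 : M * M / (√2 * √l * √M) = M * √M / (√2 * √l) := by
        have := Real.mul_self_sqrt hM0.le
        have h3 := Real.sqrt_pos.2 hM0
        field_simp
        nlinarith
      rw [hlM, h2, f1]
      have := Real.mul_self_sqrt hl0.le
      have h3 := Real.sqrt_pos.2 hl0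
      field_simp
      nlinarith
    have hα' : a * (1 - α) = α := by rw [ha]; field_simp
    calc _ = 4 * a / 3 * (M * M / √(2 * κ * M ^ q)) * beta a (1 / 2) := by
          rw [hd, hr, hbc]; field_simp; ring
      _ = a * (κ ^ a * √κ * (2 * √2 / 3) * beta a (1 / 2)) / (l ^ a * l) := by
          rw [f3]
          field_simp
          rw [Real.sq_sqrt zero_le_two]
          ring
      _ = α ^ a * α / (l ^ a * l) := by
          rw [hκa, ← mul_assoc, hα', mul_comm]
      _ = w := by rw [← f2]; field_simp
  refine ⟨ψ, hmass ▸ hψ, ?_⟩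
  rw [hE, ← hq]
  congr 1
  -- The ratio of energy to mass is l(a+1)/a = l/α, and wl/α = w^α.
  calc _ = (d * M * (2 * a / (2 * a + 1) * beta (1 / 2) a)) * (κ * M ^ q / M) * ((a + 1) / a) := by
        field_simp
    _ = w * l * α⁻¹ := by rw [hmass, hMl, hα]; field_simp
    _ = w ^ α := by rw [hl, Real.rpow_sub_one hw.ne']; field_simp

end Profile

/-! ### The inverse problem and the main theorem. -/

theorem solvesInverseProblem_rpow {α a κ : ℝ} {τ c : ℝ≥0 → ℝ≥0} (hα₀ : 0 < α) (hα₁ : α < 1)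
    (hκ : 0 < κ) (ha : a = α / (1 - α))
    (hκa : κ ^ a * √κ * (2 * √2 / 3) * ProbabilityTheory.beta a (1 / 2) = (1 - α) * α ^ a)
    (hτ : ∀ w, τ w = w ^ α) (hc₀ : c 0 = 0)
    (hcp : ∀ φ, 0 < φ → (c φ : ℝ) = κ * (φ : ℝ) ^ (1 - 3 / (2 * a + 1))) :
    SolvesInverseProblem τ c := by
  intro w
  have hτw : (τ w : ℝ≥0∞) = ENNReal.ofReal ((w : ℝ) ^ α) := by
    rw [hτ, ← NNReal.coe_rpow, ENNReal.ofReal_coe_nnreal]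
  rw [hτw]
  refine le_antisymm (le_sInf ?_) (sInf_le ?_)
  · rintro _ ⟨ψ, hψ, rfl⟩
    exact rpow_le_phaseFieldEnergy hα₀ hα₁ hκ ha rfl hκa hcp w.coe_nonneg hψ
  -- At w = 0 the slope of τ is infinite; the zero field serves instead.
  · rcases eq_zero_or_pos w with rfl | hw
    · refine ⟨fun _ => 0, ⟨fun a b => ?_, integrable_zero _ _ _, by simp⟩, ?_⟩
      · exact (LipschitzWith.const (0 : ℝ)).lipschitzOnWith.absolutelyContinuousOnInterval
      · simp [phaseFieldEnergy, hc₀, Real.zero_rpow hα₀.ne']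
    · exact exists_optimal_phaseField hα₀ hα₁ hκ ha hκa hc₀ hcp hw

end PhaseField

theorem mainTheorem8 (α β K : ℝ) (hα₀ : 0 < α) (hα₁ : α < 1)
    (hβ : β = 1 / 2 + α / (1 - α))
    (hK : K = (1 - α) / α * α ^ (1 / (1 - α)) * ((2 * β - 1) / (2 * √(2 * Real.pi)))
      * (3 * Real.Gamma β / (2 * Real.Gamma (β + 1 / 2))))
    (τ : ℝ≥0 → ℝ≥0) (hτ : ∀ w, τ w = w ^ α)
    (g : ℝ≥0 → ℝ≥0∞) (hg : ∀ s, g s = ENNReal.ofReal K * (s : ℝ≥0∞) ^ (-β))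
    (z : ℝ≥0 → ℝ≥0∞) (hz : ∀ φ, z φ = PhaseField.genInv g (φ ^ (3 / 2 : ℝ)))
    (c : ℝ≥0 → ℝ≥0) (hc₀ : c 0 = 0)
    (hc : ∀ φ, 0 < φ → (c φ : ℝ) =
      K ^ (2 * (1 - α) / (1 + α)) * (φ : ℝ) ^ (2 * (2 * α - 1) / (1 + α))) :
    -- the transport cost is admissible, and its conjugate is given explicitly
    PhaseField.IsAdmissible τ ∧
    PhaseField.costConjugate τ 0 = ⊤ ∧
    (∀ t : ℝ, 0 < t → PhaseField.costConjugate τ t =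
      (((1 - α) * (t / α) ^ (α / (α - 1)) : ℝ) : EReal)) ∧
    -- the constant `K` is positive and has a second expression
    0 < K ∧
    K = α ^ (1 / (1 - α)) * (1 / √(2 * Real.pi))
      * (3 * Real.Gamma (1 / 2 + α / (1 - α)) / (2 * Real.Gamma (1 + α / (1 - α)))) ∧
    -- `g` solves the deconvolution problem
    PhaseField.SolvesDeconvolution τ g ∧
    -- `g` is the nonlinear transformation of `z`, and `c(φ) = φ z(φ)` is the explicit cost
    (∀ s, g s = (PhaseField.genInv z s) ^ (3 / 2 : ℝ)) ∧
    (∀ φ, (c φ : ℝ≥0∞) = φ * z φ) ∧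
    (∀ φ, 0 < φ → (c φ : ℝ) =
      φ * (1 / K * (φ : ℝ) ^ (3 / 2 : ℝ)) ^ (-(2 * ((1 - α) / (1 + α))))) ∧
    -- `c` solves the inverse problem for `τ`
    PhaseField.SolvesInverseProblem τ c := by
  have h1 : 0 < 1 - α := by linarith
  obtain ⟨a, ha⟩ : ∃ a, a = α / (1 - α) := ⟨_, rfl⟩
  have ha0 : 0 < a := by rw [ha]; positivity
  rw [← ha] at hβ
  have hβ0 : 0 < β := by rw [hβ]; positivity
  have hβ' : β = (1 + α) / (2 * (1 - α)) := by rw [hβ, ha]; field_simp; ring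
  have hK' := PhaseField.deconvolution_constant hα₀ hα₁ ha hβ hK
  have hK0 : 0 < K := by
    have := Real.Gamma_pos_of_pos hβ0
    have := Real.Gamma_pos_of_pos (show 0 < a + 1 by positivity)
    rw [hK']
    positivity
  have hKb := PhaseField.const_mul_beta_eq hα₀ hα₁ ha hβ hK'
  have e1 : 2 * (1 - α) / (1 + α) = 1 / β := by rw [hβ']; field_simp
  have e2 : 2 * (2 * α - 1) / (1 + α) = 1 - 3 / (2 * a + 1) := by
    rw [ha]
    have : 2 * (α / (1 - α)) + 1 = (1 + α) / (1 - α) := by field_simp; ring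
    rw [this]
    field_simp
    ring
  have e3 : 3 / (2 * a + 1) = 3 / (2 * β) := by rw [hβ]; ring_nf
  simp only [e1, e2] at hc
  have hcp := hc
  set κ := K ^ (1 / β) with hκdef
  have hκ : 0 < κ := by positivity
  -- Since κ^(a+1/2) = κ^β, the Beta identity for `K` becomes the one required of `κ`.
  have hκK : κ ^ a * √κ = K := by
    rw [Real.sqrt_eq_rpow, ← Real.rpow_add hκ, add_comm, ← hβ, hκdef, ← Real.rpow_mul hK0.le,
      one_div_mul_cancel hβ0.ne', Real.rpow_one]
  rw [← hκK] at hKb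
  have hz' : ∀ φ, z φ = ENNReal.ofReal κ * (φ : ℝ≥0∞) ^ (-(3 / (2 * β))) := by
    intro φ
    rw [hz, PhaseField.genInv_const_mul_rpow (by simpa using hK0) ENNReal.ofReal_ne_top hβ0 hg,
      ENNReal.ofReal_rpow_of_pos hK0, ENNReal.coe_rpow_of_nonneg φ (show (0 : ℝ) ≤ 3 / 2 by norm_num),
      ← ENNReal.rpow_mul]
    congr 2
    field_simp
  refine ⟨PhaseField.isAdmissible_rpow hα₀ hα₁ hτ, PhaseField.costConjugate_rpow_zero hα₀ hτ,
    fun t ht => PhaseField.costConjugate_rpow hα₀ hα₁ hτ ht, hK0, ?_,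
    PhaseField.solvesDeconvolution_rpow hα₀ hα₁ ha hβ hK0 (hκK ▸ hKb) hτ hg, fun s => ?_,
    fun φ => ?_, fun φ hφ => ?_,
    PhaseField.solvesInverseProblem_rpow hα₀ hα₁ hκ ha hKb hτ hc₀ hcp⟩
  · rw [← ha, ← hβ, PhaseField.one_add_div_one_sub hα₁, ← ha, add_comm 1 a]
    exact hK'
  · rw [PhaseField.genInv_const_mul_rpow (by simpa using hκ) ENNReal.ofReal_ne_top
      (by positivity) hz', hg, ENNReal.mul_rpow_of_nonneg _ _ (by norm_num), ← ENNReal.rpow_mul,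
      ← ENNReal.rpow_mul, ENNReal.ofReal_rpow_of_pos hκ, hκdef, ← Real.rpow_mul hK0.le]
    congr 2
    · rw [show 1 / β * (1 / (3 / (2 * β)) * (3 / 2)) = 1 by field_simp, Real.rpow_one]
    · field_simp
  · rcases eq_zero_or_pos φ with rfl | hφ
    · simp [hc₀]
    · have hφ' : (0 : ℝ) < φ := hφ
      rw [hz', ← ENNReal.ofReal_coe_nnreal, hcp φ hφ, ← ENNReal.ofReal_coe_nnreal,
        ENNReal.ofReal_rpow_of_pos hφ', ← ENNReal.ofReal_mul hκ.le,
        ← ENNReal.ofReal_mul φ.coe_nonneg, e3, Real.rpow_sub hφ', Real.rpow_one,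
        Real.rpow_neg hφ'.le]
      congr 1
      ring
  · have hφ' : (0 : ℝ) < φ := hφ
    rw [hcp φ hφ, show 2 * ((1 - α) / (1 + α)) = 1 / β by rw [← e1]; ring,
      Real.mul_rpow (by positivity) (by positivity), one_div K, Real.inv_rpow hK0.le,
      Real.rpow_neg hK0.le, inv_inv, ← Real.rpow_mul hφ'.le, e3, sub_eq_neg_add,
      Real.rpow_add_one hφ'.ne', show (3 / 2 : ℝ) * -(1 / β) = -(3 / (2 * β)) by field_simp]
    ring
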